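/- Theorem 3.2. Setting. Let $\mu$ be a symmetric Borel probability measure on $\mathbb{R}$ whose support is infinite and contained in $[-1,1]$, and let $(P_n)_{n\ge 0}\subseteq\mathbb{R}[x]$ be the orthogonal polynomial sequence with respect to $\mu$ ($\deg P_n=n$) normalized by $P_n(1)=1$; call such a sequence a random walk polynomial sequence (RWPS). There is a unique sequence $(c_n)_{n\ge 0}$ with $c_0=0$, $c_n\in(0,1)$ for $n\ge 1$, and $xP_n(x)=(1-c_n)P_{n+1}(x)+c_nP_{n-1}(x)$ for $n\ge 0$ (with $c_0P_{-1}:=0$), and a unique sequence $(P_n^*)_{n\ge 0}$ of polynomials, $\deg P_n^*=n$, which is orthogonal with respect to $(1-x^2)\,\mathrm{d}\mu(x)$ and normalized by $P_n^*(1)=1$. For an integer $k\ge 1$, the RWPS $(P_n)$ is called $k$-sieved if there is an RWPS $(P_n')$ (with respect to some measure of the above kind) with recurrence coefficients $(c_n')$ such that the recurrence coefficients of $(P_n)$ satisfy $c_n=c'_{n/k}$ if $k\mid n$ and $c_n=\tfrac12$ if $k\nmid n$. Let $T_n,U_n$ be the Chebyshev polynomials of the first and second kind, $U_{-1}:=0$,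 let $\mathrm{D}_k\colon\mathbb{R}[x]\to\mathbb{R}[x]$ be the linear operator with $$\mathrm{D}_kT_n(x)=U_{n-1}\left(\left|\cos\left(\tfrac{\pi}{k}\right)\right|\right)U_{n-1}(x),\qquad n\ge 0,$$ and put $\kappa_n(j;k):=\int_{\mathbb{R}}\mathrm{D}_kP_n(x)\,P_j(x)\,\mathrm{d}\mu(x)$ for $n,j\ge0$, and $\sigma(n;k):=\kappa_n(n-1;k)$ for $n\ge 1$. Statement. If $k\ge 2$, then the following are equivalent: (i) $(P_n)_{n\ge0}$ is $k$-sieved; (ii) $\mathrm{D}_kP_n(x)=\mathrm{D}_kP_n(1)\,P_{n-1}^*(x)$ for all $n\ge 1$; (iii) for all $n\ge 2$, $(1-x^2)\mathrm{D}_kP_n(x)$ is orthogonal to $P_0,\dots,P_{n-2}$ with respect to $\mu$; (iv) $\kappa_{n+2}(n-1;k)=\sigma(n+2;k)$ for all $n\ge 1$, and for every $n\ge 1$ there is an $m\in\{0,\dots,\lfloor (n-1)/2\rfloor\}$ such that $\kappa_{n+4}(n-1-2m;k)=\sigma(n+4;k)$. If $k=1$, then (ii), (iii) and (iv) are equivalent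 to (i') $(P_n)_{n\ge 0}$ is the sequence of ultraspherical polynomials with parameter $\alpha=\frac{1}{2c_1}-\frac32$, i.e. $\alpha>-1$ and $(P_n)$ is the sequence of polynomials, $\deg P_n=n$, $P_n(1)=1$, which is orthogonal with respect to $(1-x^2)^{\alpha}\,\mathrm{d}x$ on $(-1,1)$. -/

import Mathlib

open Polynomial MeasureTheory

noncomputable section

namespace SievedRWPS

/-- An orthogonalization measure: a symmetric Borel probability measure on `ℝ` with infinite
support contained in `[-1, 1]`. -/
structure IsOrthogonalizationMeasure (μ : Measure ℝ) : Prop where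
  isProbabilityMeasure : IsProbabilityMeasure μ
  symmetric : μ.map (fun x : ℝ => -x) = μ
  support_infinite : μ.support.Infinite
  support_subset : μ.support ⊆ Set.Icc (-1) 1

/-- `P` is the orthogonal polynomial sequence with respect to `ν`
(with `P n` of exact degree `n`), normalized by `P n (1) = 1`. -/
structure IsNormalizedOPS (ν : Measure ℝ) (P : ℕ → ℝ[X]) : Prop where
  natDegree_eq : ∀ n, (P n).natDegree = n
  orthogonal : ∀ m n, m ≠ n → ∫ x, (P m).eval x * (P n).eval x ∂ν = 0
  eval_one : ∀ n, (P n).eval 1 = 1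

/-- `P` is the (symmetric) random walk polynomial sequence with respect to `μ`. -/
structure IsRWPS (μ : Measure ℝ) (P : ℕ → ℝ[X]) : Prop where
  isOrthogonalizationMeasure : IsOrthogonalizationMeasure μ
  isNormalizedOPS : IsNormalizedOPS μ P

/-- `c` is the sequence of recurrence coefficients of `P`: one has `P 0 = 1`, `c 0 = 0`,
`c n ∈ (0, 1)` for `n ≥ 1` and `x P n = (1 - c n) P (n + 1) + c n P (n - 1)` for `n ≥ 0`
(for `n = 0` the last summand vanishes). -/
structure IsRecurrenceCoeff (P : ℕ → ℝ[X]) (c : ℕ → ℝ) : Prop where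
  zero_eq_one : P 0 = 1
  coeff_zero : c 0 = 0
  coeff_mem : ∀ n, 1 ≤ n → c n ∈ Set.Ioo (0 : ℝ) 1
  recurrence : ∀ n, X * P n = C (1 - c n) * P (n + 1) + C (c n) * P (n - 1)

/-- The sieved recurrence coefficients `c(n; k)`. -/
def sieve (k : ℕ) (c : ℕ → ℝ) (n : ℕ) : ℝ :=
  if k ∣ n then c (n / k) else 1 / 2

/-- `P` is `k`-sieved: it is the `k`-sieved RWPS which corresponds to some RWPS. -/
def IsSieved (k : ℕ) (P : ℕ → ℝ[X]) : Prop :=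
  ∃ (μ' : Measure ℝ) (P' : ℕ → ℝ[X]) (c' : ℕ → ℝ),
    IsRWPS μ' P' ∧ IsRecurrenceCoeff P' c' ∧ IsRecurrenceCoeff P (sieve k c')

/-- The measure `dμ*(x) = (1 - x²) dμ(x)`. -/
def starMeasure (μ : Measure ℝ) : Measure ℝ :=
  μ.withDensity (fun x => ENNReal.ofReal (1 - x ^ 2))

/-- The ultraspherical weight `(1 - x²)^α dx` on `(-1, 1)`. -/
def ultrasphericalMeasure (α : ℝ) : Measure ℝ :=
  (volume.restrict (Set.Ioo (-1 : ℝ) 1)).withDensity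
    (fun x => ENNReal.ofReal ((1 - x ^ 2) ^ α))

/-- `P` is the sequence of ultraspherical polynomials with parameter `α > -1`, normalized to take
the value `1` at `1`. Rescaling the weight to a probability measure does not affect this. -/
def IsUltraspherical (α : ℝ) (P : ℕ → ℝ[X]) : Prop :=
  -1 < α ∧ IsNormalizedOPS (ultrasphericalMeasure α) P

/-- The Chebyshev polynomials of the first kind as a basis of `ℝ[X]`. -/
def chebyshevBasis : Module.Basis ℕ ℝ ℝ[X] :=
  (Chebyshev.chebyshevTsequence ℝ).basis fun i =>
    isUnit_iff_ne_zero.mpr (leadingCoeff_ne_zero.mpr ((Chebyshev.chebyshevTsequence ℝ).ne_zero i))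

theorem chebyshevBasis_apply (n : ℕ) : chebyshevBasis n = Chebyshev.T ℝ n := by
  simp [chebyshevBasis, Chebyshev.chebyshevTsequence]

/-- The sieved Askey–Wilson operator: the linear operator on `ℝ[X]` with
`T n ↦ U (n - 1) (|cos (π / k)|) • U (n - 1)`, where `U (-1) = 0`. -/
def sievedAW (k : ℕ) : ℝ[X] →ₗ[ℝ] ℝ[X] :=
  chebyshevBasis.constr ℝ fun n : ℕ =>
    (Chebyshev.U ℝ ((n : ℤ) - 1)).eval |Real.cos (Real.pi / k)| • Chebyshev.U ℝ ((n : ℤ) - 1)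

theorem sievedAW_T (k n : ℕ) :
    sievedAW k (Chebyshev.T ℝ n) =
      (Chebyshev.U ℝ ((n : ℤ) - 1)).eval |Real.cos (Real.pi / k)| •
        Chebyshev.U ℝ ((n : ℤ) - 1) := by
  rw [← chebyshevBasis_apply, sievedAW, Module.Basis.constr_basis]

/-- The Fourier coefficients `κ_n(j; k)` of `D_k P_n`. -/
def kappa (μ : Measure ℝ) (P : ℕ → ℝ[X]) (k n j : ℕ) : ℝ :=
  ∫ x, (sievedAW k (P n)).eval x * (P j).eval x ∂μ

/-- `σ(n; k) = κ_n(n - 1; k)` for `n ≥ 1`. -/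
def sigma (μ : Measure ℝ) (P : ℕ → ℝ[X]) (k n : ℕ) : ℝ :=
  kappa μ P k n (n - 1)

/-- `D_k P_n = D_k P_n(1) P*_{n-1}` for all `n ≥ 1`, where `Q` is the sequence `P*`. -/
def StarCondition (P Q : ℕ → ℝ[X]) (k : ℕ) : Prop :=
  ∀ n, 1 ≤ n → sievedAW k (P n) = C ((sievedAW k (P n)).eval 1) * Q (n - 1)

/-- For all `n ≥ 2`, `(1 - x²) D_k P_n` is orthogonal to `P_0, …, P_{n-2}` with respect to `μ`. -/
def OrthogonalityCondition (μ : Measure ℝ) (P : ℕ → ℝ[X]) (k : ℕ) : Prop :=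
  ∀ n, 2 ≤ n → ∀ j, j ≤ n - 2 →
    ∫ x, ((1 - x ^ 2) * (sievedAW k (P n)).eval x) * (P j).eval x ∂μ = 0

/-- The pointwise condition on the Fourier coefficients of `D_k P_n`. -/
def PointwiseCondition (μ : Measure ℝ) (P : ℕ → ℝ[X]) (k : ℕ) : Prop :=
  (∀ n, 1 ≤ n → kappa μ P k (n + 2) (n - 1) = sigma μ P k (n + 2)) ∧
  ∀ n, 1 ≤ n → ∃ m, m ≤ (n - 1) / 2 ∧
    kappa μ P k (n + 4) (n - 1 - 2 * m) = sigma μ P k (n + 4)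

end SievedRWPS

end

/-! Write D for D_k, γ = |cos(π/k)| and w_n = U_{n-1}(γ). Everything rests on the second-order
product rule D(x²f) = 2γx D(xf) + (1 - γ² - x²) Df (`sievedAW_X_sq_mul`), which holds because D T_n
= w_n U_{n-1} and both factors solve Chebyshev recurrences. Paired with P_j, it becomes a linear
relation among the Fourier coefficients κ_n(j) (`IsSymmOPS.awForm_recurrence`).

Conditions (ii), (iii) and (iv) all say that, for each n, κ_n(j) is constant over the j < n of
parity opposite to n (`ShiftInvariant`); for the other parity it vanishes. For (iii) this is because
(1 - x²)P_j is a combination of P_j - P_{j+2} and P_{j-2} - P_j. For (ii), P*_{n-1} spans the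
polynomials of degree below n that are orthogonal, under (1 - x²)dμ, to all degrees below n - 1. For
(iv), the relation among the κ carries coincidences from smaller n to n, except for at most two of
them, and these are what (iv) supplies.

Let k ≥ 2. Then w_n = 0 exactly when k ∣ n, so the sieved shape of c means w_n(2c_n - 1) = 0, and
this forces (1 - x²)D P_n = w_n(xP_n - P_{n+1}), hence (iii). Conversely, the coincidences make
w_n(1 - c_n)/c_n obey the recurrence of w_n; since w_k = 0, this gives c_n = c_1 for k ∤ n, and one
low-order relation yields c_1 = 1/2 (`IsSymmOPS.coeff_eq_half`). Coefficients of this shape do come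
from an RWPS: P_{kn} is a polynomial in T_k, and the symmetrized image of μ under T_k is the
required measure (`isSieved_of_coeff`).

For k = 1, D is d/dx, and (iii) is equivalent to the Pearson equation L((1 - x²)p') = rL(xp) with r
= 1/c_1 - 1. This determines all moments up to scaling and is satisfied by (1 - x²)^α with 2α + 2 =
r. -/

namespace SievedRWPS

/-! ### The operator D_k: product rule, degree, parity, weights -/

/-- The point `|cos (π / k)|` at which the weights of `sievedAW k` are evaluated. -/
noncomputable def node (k : ℕ) : ℝ := |Real.cos (Real.pi / k)|

/-- The weight `U (n - 1) (|cos (π / k)|)` of the operator `sievedAW k`. -/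
noncomputable def weight (k : ℕ) (n : ℤ) : ℝ := (Chebyshev.U ℝ (n - 1)).eval (node k)

theorem weight_zero (k : ℕ) : weight k 0 = 0 := by simp [weight]

theorem weight_one (k : ℕ) : weight k 1 = 1 := by simp [weight]

theorem weight_add_one (k : ℕ) (n : ℤ) :
    weight k (n + 1) = 2 * node k * weight k n - weight k (n - 1) := by
  have h := congrArg (Polynomial.eval (node k)) (Chebyshev.U_eq ℝ n)
  simp only [eval_sub, eval_mul, eval_X, eval_ofNat] at h
  rw [weight, weight, weight, show n + 1 - 1 = n by ring, h, show n - 1 - 1 = n - 2 by ring]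

theorem weight_two (k : ℕ) : weight k 2 = 2 * node k := by
  have := weight_add_one k 1
  norm_num [weight_one, weight_zero] at this
  exact this

theorem weight_three (k : ℕ) : weight k 3 = 4 * node k ^ 2 - 1 := by
  have := weight_add_one k 2
  norm_num [weight_one, weight_two] at this
  rw [this]; ring

/-- T is even in its index, while the weight and U_{n-1} are both odd, so the two signs cancel.
Integer indices avoid a separate case for x T_0, where T_{-1} appears. -/
theorem sievedAW_T_int (k : ℕ) (n : ℤ) :
    sievedAW k (Chebyshev.T ℝ n) = weight k n • Chebyshev.U ℝ (n - 1) := by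
  obtain ⟨m, rfl | rfl⟩ := n.eq_nat_or_neg
  · exact sievedAW_T k m
  · rw [Chebyshev.T_neg, sievedAW_T, weight, Chebyshev.U_neg_sub_one]
    simp [node]

theorem induction_chebyshev {M : ℝ[X] → Prop} (hT : ∀ n : ℕ, M (Chebyshev.T ℝ n))
    (hadd : ∀ p q, M p → M q → M (p + q)) (hsmul : ∀ (a : ℝ) p, M p → M (a • p)) (p : ℝ[X]) :
    M p := by
  have h0 : M 0 := by simpa using hsmul 0 _ (hT 0)
  have hp : p ∈ Submodule.span ℝ (Set.range chebyshevBasis) := by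
    rw [chebyshevBasis.span_eq]; trivial
  induction hp using Submodule.span_induction with
  | mem x hx => obtain ⟨n, rfl⟩ := hx; rw [chebyshevBasis_apply]; exact hT n
  | zero => exact h0
  | add x y _ _ hx hy => exact hadd _ _ hx hy
  | smul a x _ hx => exact hsmul _ _ hx

theorem X_mul_T (n : ℤ) : X * Chebyshev.T ℝ n =
    (1 / 2 : ℝ) • (Chebyshev.T ℝ (n + 1) + Chebyshev.T ℝ (n - 1)) := by
  rw [Chebyshev.T_add_one, smul_eq_C_mul]
  have h : (C (1 / 2 : ℝ) : ℝ[X]) * 2 = 1 := by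
    rw [show (2 : ℝ[X]) = C 2 from rfl, ← C_mul]; norm_num
  linear_combination (-X * Chebyshev.T ℝ n) * h

/-- By linearity f = T_n suffices. There every term reduces to two consecutive weights times two
consecutive U's by the two Chebyshev recurrences, one in γ and one in x. This replaces the Leibniz
rule, which D_k lacks for general k. -/
theorem sievedAW_X_sq_mul (k : ℕ) (f : ℝ[X]) :
    sievedAW k (X * (X * f)) = C (2 * node k) * X * sievedAW k (X * f) +
      (C (1 - node k ^ 2) - X ^ 2) * sievedAW k f := by
  induction f using induction_chebyshev with
  | hT n =>
    have e1 : (n : ℤ) + 1 - 1 = n := by ring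
    have e2 : (n : ℤ) - 1 + 1 = n := by ring
    simp only [X_mul_T, mul_add, mul_smul_comm, map_add, map_smul, sievedAW_T_int, e1, e2]
    have hw := weight_add_one k n
    have hw1 := weight_add_one k (n + 1)
    have hw2 := weight_add_one k (n - 1)
    have hU := Chebyshev.U_add_one ℝ (n - 1)
    have hU1 := Chebyshev.U_add_one ℝ n
    have hU2 := Chebyshev.U_add_one ℝ (n - 1 - 1)
    rw [e1] at hw1
    rw [e2] at hw2 hU
    rw [show (n : ℤ) - 1 - 1 + 1 = n - 1 by ring] at hU2
    have hW2 : weight k (n - 1 - 1) = 2 * node k * weight k (n - 1) - weight k n := by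
      linarith
    have hV2 : Chebyshev.U ℝ ((n : ℤ) - 1 - 1 - 1) =
        2 * X * Chebyshev.U ℝ ((n : ℤ) - 1 - 1) - Chebyshev.U ℝ ((n : ℤ) - 1) := by
      rw [hU2]; ring
    have h2 : (C (1 / 2 : ℝ) : ℝ[X]) * 2 = 1 := by
      rw [show (2 : ℝ[X]) = C 2 from rfl, ← C_mul]; norm_num
    rw [show (n : ℤ) + 1 + 1 - 1 = n + 1 by ring, hw1, hW2, hw, hU1, hV2, hU]
    simp only [smul_eq_C_mul, map_sub, map_mul, map_pow, map_one]
    rw [show (C (2 : ℝ) : ℝ[X]) = 2 from rfl]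
    generalize (C (1 / 2 : ℝ) : ℝ[X]) = h at *
    generalize Chebyshev.U ℝ ((n : ℤ) - 1) = u
    generalize Chebyshev.U ℝ ((n : ℤ) - 1 - 1) = u'
    generalize (C (weight k n) : ℝ[X]) = w
    generalize (C (weight k (n - 1)) : ℝ[X]) = w'
    generalize (C (node k) : ℝ[X]) = g
    linear_combination (h * ((2 * g * w - w') * (2 * g * X * (2 * X * u - u')) +
      w' * (2 * g * X * u')) + w * ((1 - g ^ 2 - X ^ 2) * u) * (2 * h + 1)) * h2
  | hadd p q hp hq => simp only [mul_add, map_add, hp, hq]; ring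
  | hsmul a p hp =>
    simp only [mul_smul_comm, map_smul, hp, smul_add]

theorem sievedAW_one (k : ℕ) : sievedAW k 1 = 0 := by
  simpa [weight_zero] using sievedAW_T_int k 0

theorem sievedAW_X (k : ℕ) : sievedAW k X = 1 := by
  simpa [weight_one] using sievedAW_T_int k 1

theorem sievedAW_X_pow_degree (k n : ℕ) : (sievedAW k (X ^ n)).degree < n := by
  induction n using Nat.twoStepInduction with
  | zero => simp [sievedAW_one]
  | one => simp [sievedAW_X]
  | more n h0 h1 =>
    rw [show (X : ℝ[X]) ^ (n + 2) = X * (X * X ^ n) by ring, sievedAW_X_sq_mul,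
      show (X : ℝ[X]) * X ^ n = X ^ (n + 1) by ring]
    rw [degree_lt_iff_coeff_zero] at *
    intro m hm
    obtain ⟨m, rfl⟩ : ∃ l, m = l + 2 := ⟨m - 2, by omega⟩
    rw [coeff_add, mul_assoc, coeff_C_mul, coeff_X_mul, sub_mul, coeff_sub, coeff_C_mul,
      coeff_X_pow_mul, h1 _ (by omega), h0 _ (by omega), h0 _ (by omega)]
    simp

theorem sievedAW_degree_lt (k : ℕ) {n : ℕ} {p : ℝ[X]} (hp : p.natDegree ≤ n) :
    (sievedAW k p).degree < n := by
  rw [p.as_sum_range_C_mul_X_pow' (Nat.lt_succ_of_le hp), map_sum]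
  refine lt_of_le_of_lt (degree_sum_le _ _) ?_
  rw [Finset.sup_lt_iff (by exact WithBot.bot_lt_coe n)]
  intro i hi
  rw [← smul_eq_C_mul, map_smul]
  refine lt_of_le_of_lt (degree_smul_le _ _) ((sievedAW_X_pow_degree k i).trans_le ?_)
  have := Finset.mem_range.1 hi
  exact_mod_cast (by omega : i ≤ n)

theorem sievedAW_comp_neg_X (k : ℕ) (p : ℝ[X]) :
    sievedAW k (p.comp (-X)) = -(sievedAW k p).comp (-X) := by
  have key : ∀ n : ℕ, sievedAW k ((X ^ n : ℝ[X]).comp (-X)) =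
      -(sievedAW k (X ^ n)).comp (-X) := by
    intro n
    induction n using Nat.twoStepInduction with
    | zero => simp [sievedAW_one]
    | one => simp [sievedAW_X]
    | more n h0 h1 =>
      have e : (X : ℝ[X]) ^ (n + 2) = X * (X * X ^ n) := by ring
      have e' : (X : ℝ[X]) * X ^ n = X ^ (n + 1) := by ring
      have e2 : ((X : ℝ[X]) ^ (n + 2)).comp (-X) = X * (X * (X ^ n : ℝ[X]).comp (-X)) := by
        simp; ring
      have e3 : X * ((X : ℝ[X]) ^ n).comp (-X) = -((X : ℝ[X]) ^ (n + 1)).comp (-X) := by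
        simp; ring
      rw [e2, sievedAW_X_sq_mul, e3, map_neg, h0, h1, e, sievedAW_X_sq_mul, e']
      simp only [add_comp, mul_comp, sub_comp, C_comp, X_comp, pow_comp]
      ring
  rw [p.as_sum_range_C_mul_X_pow]
  simp only [sum_comp, map_sum, ← smul_eq_C_mul, map_smul, smul_comp]
  rw [← Finset.sum_neg_distrib]
  refine Finset.sum_congr rfl fun i _ => ?_
  rw [key, smul_neg]

theorem node_one : node 1 = 1 := by simp [node]

theorem sievedAW_one_eq_derivative (p : ℝ[X]) : sievedAW 1 p = derivative p := by
  induction p using induction_chebyshev with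
  | hT n =>
    rw [sievedAW_T_int, weight, node_one, Chebyshev.U_eval_one, Chebyshev.T_derivative_eq_U,
      smul_eq_C_mul]
    simp
  | hadd p q hp hq => simp [hp, hq]
  | hsmul a p hp => simp [hp]

section weight

variable {k : ℕ}

theorem sin_pi_div_pos (hk : 2 ≤ k) : 0 < Real.sin (Real.pi / k) := by
  have h2 : (2 : ℝ) ≤ k := by exact_mod_cast hk
  refine Real.sin_pos_of_pos_of_lt_pi (by positivity) ?_
  exact div_lt_self Real.pi_pos (by linarith)

theorem node_eq_cos (hk : 2 ≤ k) : node k = Real.cos (Real.pi / k) := by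
  have h2 : (2 : ℝ) ≤ k := by exact_mod_cast hk
  refine abs_of_nonneg (Real.cos_nonneg_of_mem_Icc ⟨?_, ?_⟩)
  · have : 0 ≤ Real.pi / k := by positivity
    linarith [Real.pi_pos]
  · exact div_le_div_of_nonneg_left Real.pi_pos.le two_pos h2

theorem node_sq_lt_one (hk : 2 ≤ k) : node k ^ 2 < 1 := by
  rw [node_eq_cos hk, Real.cos_sq']
  nlinarith [sin_pi_div_pos hk]

theorem weight_mul_sin (hk : 2 ≤ k) (n : ℤ) :
    weight k n * Real.sin (Real.pi / k) = Real.sin (n * (Real.pi / k)) := by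
  rw [weight, node_eq_cos hk, Chebyshev.U_real_cos]
  congr 2
  push_cast; ring

theorem weight_eq_zero_iff (hk : 2 ≤ k) (n : ℕ) : weight k n = 0 ↔ k ∣ n := by
  have hs := sin_pi_div_pos hk
  have h0 : (k : ℝ) ≠ 0 := by positivity
  have : weight k n = 0 ↔ Real.sin (n * (Real.pi / k)) = 0 := by
    rw [← Int.cast_natCast (R := ℝ) n, ← weight_mul_sin hk]
    simp [hs.ne']
  rw [this, Real.sin_eq_zero_iff]
  constructor
  · rintro ⟨m, hm⟩
    have : (m * k : ℝ) = n := by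
      have hpi := Real.pi_pos.ne'
      field_simp at hm
      linarith
    have h2 : m * (k : ℤ) = n := by exact_mod_cast this
    exact Int.natCast_dvd_natCast.1 ⟨m, by rw [← h2]; ring⟩
  · rintro ⟨m, rfl⟩
    exact ⟨m, by push_cast; field_simp⟩

/-- sin(π - π/k) = sin(π/k). Any nonzero value would do later: it is used to see that a solution
vanishing at k is trivial. -/
theorem weight_sub_one (hk : 2 ≤ k) : weight k ((k : ℤ) - 1) = 1 := by
  have hs := sin_pi_div_pos hk
  have h0 : (k : ℝ) ≠ 0 := by positivity
  have := weight_mul_sin hk ((k : ℤ) - 1)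
  rw [show (((k : ℤ) - 1 : ℤ) : ℝ) * (Real.pi / k) = Real.pi - Real.pi / k by
    push_cast; field_simp, Real.sin_pi_sub] at this
  exact mul_right_cancel₀ hs.ne' (by rw [this, one_mul])

end weight

/-! ### Orthogonal polynomials of a linear functional -/

/-- A linear functional on polynomials which is positive definite. -/
def IsPosDef (L : ℝ[X] →ₗ[ℝ] ℝ) : Prop := ∀ p : ℝ[X], p ≠ 0 → 0 < L (p * p)

/-- `P` is the orthogonal polynomial sequence of the functional `L`, normalized at `1`. -/
structure IsOPS (L : ℝ[X] →ₗ[ℝ] ℝ) (P : ℕ → ℝ[X]) : Prop where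
  natDegree_eq : ∀ n, (P n).natDegree = n
  orthogonal : ∀ m n, m ≠ n → L (P m * P n) = 0
  eval_one : ∀ n, (P n).eval 1 = 1

theorem map_C_mul (L : ℝ[X] →ₗ[ℝ] ℝ) (a : ℝ) (p : ℝ[X]) : L (C a * p) = a * L p := by
  rw [← smul_eq_C_mul, map_smul, smul_eq_mul]

theorem degree_le_of_lt_succ {p : ℝ[X]} {n : ℕ}
    (hp : p.degree < (n + 1 : ℕ)) : p.degree ≤ n := by
  rw [degree_le_iff_coeff_zero]
  intro m hm
  exact (degree_lt_iff_coeff_zero _ _).1 hp m (Nat.succ_le_of_lt (WithBot.coe_lt_coe.1 hm))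

namespace IsOPS

variable {L : ℝ[X] →ₗ[ℝ] ℝ} {P Q : ℕ → ℝ[X]}

theorem ne_zero (h : IsOPS L P) (n : ℕ) : P n ≠ 0 := by
  intro h0
  have := h.eval_one n
  simp [h0] at this

theorem degree_eq (h : IsOPS L P) (n : ℕ) : (P n).degree = n := by
  rw [degree_eq_natDegree (h.ne_zero n), h.natDegree_eq]

theorem zero_eq_one (h : IsOPS L P) : P 0 = 1 := by
  have h1 := eq_C_of_natDegree_eq_zero (h.natDegree_eq 0)
  have h2 := h.eval_one 0
  rw [h1, eval_C] at h2
  rw [h1, h2, C_1]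

theorem coeff_ne_zero (h : IsOPS L P) (n : ℕ) : (P n).coeff n ≠ 0 := by
  have := leadingCoeff_ne_zero.2 (h.ne_zero n)
  rwa [leadingCoeff, h.natDegree_eq] at this

theorem degree_sub_lt (h : IsOPS L P) {n : ℕ} {p : ℝ[X]} (hp : p.degree ≤ n) :
    (p - C (p.coeff n / (P n).coeff n) * P n).degree < n := by
  rw [degree_lt_iff_coeff_zero]
  intro m hm
  rw [coeff_sub, coeff_C_mul]
  rcases hm.eq_or_lt with hm | hm
  · subst hm
    rw [div_mul_cancel₀ _ (h.coeff_ne_zero _), sub_self]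
  · rw [coeff_eq_zero_of_degree_lt (hp.trans_lt (WithBot.coe_lt_coe.2 hm)),
      coeff_eq_zero_of_degree_lt ((h.degree_eq n).trans_lt (WithBot.coe_lt_coe.2 hm))]
    simp

/-- P_0, …, P_{n-1} is a basis of the polynomials of degree below n, peeled off from the top by
matching leading coefficients. -/
theorem induction_degree_lt (h : IsOPS L P) {M : ℝ[X] → Prop} (h0 : M 0) (n : ℕ)
    (hP : ∀ (p : ℝ[X]) (a : ℝ) (j), j < n → M p → M (p + C a * P j)) :
    ∀ p : ℝ[X], p.degree < n → M p := by
  induction n with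
  | zero =>
    intro p hp
    rw [degree_lt_iff_coeff_zero] at hp
    have : p = 0 := by ext i; simpa using hp i (Nat.zero_le _)
    rwa [this]
  | succ n ih =>
    intro p hp
    have := ih (fun q a j hj hq => hP q a j (by omega) hq) _
      (h.degree_sub_lt (degree_le_of_lt_succ hp))
    simpa using hP _ (p.coeff n / (P n).coeff n) n (Nat.lt_succ_self n) this

theorem induction (h : IsOPS L P) {M : ℝ[X] → Prop} (h0 : M 0)
    (hP : ∀ (p : ℝ[X]) (a : ℝ) (j), M p → M (p + C a * P j)) (p : ℝ[X]) : M p :=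
  h.induction_degree_lt h0 (p.natDegree + 1) (fun p a j _ => hP p a j) p
    (degree_le_natDegree.trans_lt (by exact_mod_cast Nat.lt_succ_self _))

theorem map_mul_eq_zero (h : IsOPS L P) {n : ℕ} {p : ℝ[X]} (hp : p.degree < n) :
    L (p * P n) = 0 := by
  refine h.induction_degree_lt (M := fun p => L (p * P n) = 0) (by simp) n ?_ p hp
  intro p a j hj hp
  rw [add_mul, map_add, hp, mul_assoc, map_C_mul, h.orthogonal j n hj.ne]
  simp

theorem map_mul_eq_zero_of_forall (h : IsOPS L P) {n : ℕ} {p q : ℝ[X]} (hq : q.degree < n)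
    (hp : ∀ j < n, L (p * P j) = 0) : L (p * q) = 0 := by
  refine h.induction_degree_lt (M := fun q => L (p * q) = 0) (by simp) n ?_ q hq
  intro q a j hj hq
  rw [mul_add, map_add, hq, mul_left_comm, map_C_mul, hp j hj]
  simp

theorem eq_zero_of_forall (h : IsOPS L P) (hL : IsPosDef L) {n : ℕ} {p : ℝ[X]}
    (hd : p.degree < n) (hp : ∀ j < n, L (p * P j) = 0) : p = 0 := by
  by_contra h0
  exact (hL p h0).ne' (h.map_mul_eq_zero_of_forall hd hp)

theorem eq_C_mul_of_forall (h : IsOPS L P) (hL : IsPosDef L) {n : ℕ} {p : ℝ[X]}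
    (hd : p.degree ≤ n) (hp : ∀ j < n, L (p * P j) = 0) :
    p = C (p.coeff n / (P n).coeff n) * P n := by
  rw [← sub_eq_zero]
  refine h.eq_zero_of_forall hL (h.degree_sub_lt hd) fun j hj => ?_
  rw [sub_mul, map_sub, hp j hj, mul_assoc, map_C_mul, h.orthogonal n j hj.ne']
  simp

theorem unique (h : IsOPS L P) (h' : IsOPS L Q) (hL : IsPosDef L) : P = Q := by
  funext n
  have h1 := h'.eq_C_mul_of_forall hL (p := P n) (n := n) (h.degree_eq n).le fun j hj => by
    rw [mul_comm]
    exact h.map_mul_eq_zero ((h'.degree_eq j).trans_lt (by exact_mod_cast hj))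
  have h2 := congrArg (eval 1) h1
  rw [eval_mul, eval_C, h.eval_one, h'.eval_one, mul_one] at h2
  rw [h1, ← h2, C_1, one_mul]

/-- The orthogonal polynomials of a symmetric functional are even or odd. -/
theorem comp_neg_X (h : IsOPS L P) (hL : IsPosDef L) (hs : ∀ p, L (p.comp (-X)) = L p) (n : ℕ) :
    (P n).comp (-X) = C ((-1) ^ n) * P n := by
  have hcoeff : ((P n).comp (-X)).coeff n = (-1) ^ n * (P n).coeff n := by
    rw [show (-X : ℝ[X]) = C (-1) * X by simp, comp_C_mul_X_coeff, mul_comm]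
  have hd : ((P n).comp (-X)).degree ≤ n := by
    refine degree_le_of_natDegree_le ?_
    rw [natDegree_comp, natDegree_neg, natDegree_X, mul_one, h.natDegree_eq]
  have h1 := h.eq_C_mul_of_forall hL hd fun j hj => by
    have : (P n).comp (-X) * P j = (P n * (P j).comp (-X)).comp (-X) := by
      rw [mul_comp, comp_assoc]; simp
    rw [this, hs, mul_comm]
    refine h.map_mul_eq_zero (lt_of_le_of_lt (degree_le_of_natDegree_le (n := j) ?_)
      (by exact_mod_cast hj))
    rw [natDegree_comp, natDegree_neg, natDegree_X, mul_one, h.natDegree_eq]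
  rw [h1, hcoeff, mul_div_assoc, div_self (h.coeff_ne_zero n), mul_one]

end IsOPS

/-- `P` is orthogonal with respect to the symmetric normalized functional `L` and has the
recurrence coefficients `c`. -/
structure IsSymmOPS (L : ℝ[X] →ₗ[ℝ] ℝ) (P : ℕ → ℝ[X]) (c : ℕ → ℝ) : Prop extends
    IsOPS L P where
  isRecurrenceCoeff : IsRecurrenceCoeff P c
  map_one : L 1 = 1
  symm : ∀ p, L (p.comp (-X)) = L p

/-! ### Consequences of the recurrence relation -/

namespace IsRecurrenceCoeff

variable {P : ℕ → ℝ[X]} {c : ℕ → ℝ}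

theorem one_sub_pos (h : IsRecurrenceCoeff P c) (n : ℕ) : 0 < 1 - c n := by
  rcases Nat.eq_zero_or_pos n with rfl | hn
  · simp [h.coeff_zero]
  · linarith [(h.coeff_mem n hn).2]

theorem pos (h : IsRecurrenceCoeff P c) (n : ℕ) : 0 < c (n + 1) :=
  (h.coeff_mem (n + 1) (by omega)).1

theorem one_eq_X (h : IsRecurrenceCoeff P c) : P 1 = X := by
  have := h.recurrence 0
  simpa [h.coeff_zero, h.zero_eq_one] using this.symm

theorem eval_one (h : IsRecurrenceCoeff P c) (n : ℕ) : (P n).eval 1 = 1 := by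
  induction n using Nat.twoStepInduction with
  | zero => simp [h.zero_eq_one]
  | one => simp [h.one_eq_X]
  | more n h0 h1 =>
    have := congrArg (eval 1) (h.recurrence (n + 1))
    simp only [eval_mul, eval_X, eval_add, eval_C, h1, h0, Nat.add_sub_cancel] at this
    have hp := (h.one_sub_pos (n + 1)).ne'
    refine mul_left_cancel₀ hp ?_
    linarith

theorem degree_eq (h : IsRecurrenceCoeff P c) (n : ℕ) : (P n).degree = n := by
  induction n using Nat.twoStepInduction with
  | zero => simp [h.zero_eq_one]
  | one => simp [h.one_eq_X]
  | more n h0 h1 =>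
    have hr := h.recurrence (n + 1)
    have hp := (h.one_sub_pos (n + 1)).ne'
    have : C (1 - c (n + 1)) * P (n + 1 + 1) = X * P (n + 1) - C (c (n + 1)) * P n := by
      rw [hr]; simp
    have hd := congrArg degree this
    rw [degree_C_mul hp, degree_sub_eq_left_of_degree_lt, degree_mul, h1, degree_X] at hd
    · rw [hd, add_comm]; norm_cast
    · rw [degree_mul (p := X), h1, degree_X]
      rw [← smul_eq_C_mul]
      refine (degree_smul_le _ _).trans_lt ?_
      rw [h0]
      norm_cast
      omega

theorem comp_neg_X (h : IsRecurrenceCoeff P c) (n : ℕ) :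
    (P n).comp (-X) = C ((-1) ^ n) * P n := by
  induction n using Nat.twoStepInduction with
  | zero => simp [h.zero_eq_one]
  | one => simp [h.one_eq_X]
  | more n h0 h1 =>
    have hr := h.recurrence (n + 1)
    have hp : (C (1 - c (n + 1)) : ℝ[X]) ≠ 0 := C_ne_zero.2 (h.one_sub_pos (n + 1)).ne'
    have hc := congrArg (fun p => p.comp (-X)) hr
    simp only [Nat.add_sub_cancel, add_comp, mul_comp, C_comp, X_comp, h0, h1] at hc hr
    refine mul_left_cancel₀ hp ?_
    have e1 : (C ((-1 : ℝ) ^ (n + 1)) : ℝ[X]) = -C ((-1) ^ n) := by rw [pow_succ]; simp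
    have e2 : (C ((-1 : ℝ) ^ (n + 2)) : ℝ[X]) = C ((-1) ^ n) := by rw [pow_add]; simp
    rw [e1] at hc
    rw [e2]
    linear_combination -hc + C ((-1) ^ n) * hr

theorem unique (h : IsRecurrenceCoeff P c) {c' : ℕ → ℝ} (h' : IsRecurrenceCoeff P c') :
    c = c' := by
  funext n
  rcases Nat.eq_zero_or_pos n with rfl | hn
  · rw [h.coeff_zero, h'.coeff_zero]
  have h1 : C (c n - c' n) * (P (n - 1) - P (n + 1)) = 0 := by
    have := (h.recurrence n).symm.trans (h'.recurrence n)
    simp only [map_sub, map_one] at this ⊢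
    linear_combination this
  rcases mul_eq_zero.1 h1 with h2 | h2
  · exact sub_eq_zero.1 (C_eq_zero.1 h2)
  · have := congrArg degree (sub_eq_zero.1 h2)
    rw [h.degree_eq, h.degree_eq] at this
    norm_cast at this
    omega

/-- The truncated indices n - 1 and n - 2 are harmless: for n = 0, 1 their terms carry the factor
c_0 = 0. -/
theorem X_mul_X_mul (h : IsRecurrenceCoeff P c) (n : ℕ) :
    X * (X * P n) = C ((1 - c n) * (1 - c (n + 1))) * P (n + 2) +
      C ((1 - c n) * c (n + 1) + c n * (1 - c (n - 1))) * P n +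
      C (c n * c (n - 1)) * P (n - 2) := by
  rw [h.recurrence n, mul_add, mul_left_comm, h.recurrence (n + 1), mul_left_comm X (C (c n))]
  rcases n with _ | n
  · simp [h.coeff_zero]
  · simp only [Nat.add_sub_cancel]
    rw [h.recurrence n]
    simp only [map_add, map_mul, map_sub, map_one]
    rw [show n + 1 - 2 = n - 1 by omega]
    ring

/-- Multiplication by `1 - x²` in terms of differences. -/
theorem one_sub_X_sq_mul (h : IsRecurrenceCoeff P c) (n : ℕ) :
    (1 - X ^ 2) * P n = C ((1 - c n) * (1 - c (n + 1))) * (P n - P (n + 2)) -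
      C (c n * c (n - 1)) * (P (n - 2) - P n) := by
  have e : (1 - X ^ 2) * P n = P n - X * (X * P n) := by ring
  rw [e, h.X_mul_X_mul]
  rcases n with _ | n
  · simp [h.coeff_zero]; ring
  · simp only [map_add, map_mul, map_sub, map_one, Nat.add_sub_cancel]
    ring

end IsRecurrenceCoeff

/-! ### Fourier coefficients of D_k P_n -/

/-- The bilinear form `(f, g) ↦ L (D_k f * g)`. -/
noncomputable def awForm (L : ℝ[X] →ₗ[ℝ] ℝ) (k : ℕ) (f g : ℝ[X]) : ℝ := L (sievedAW k f * g)

section awForm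

variable (L : ℝ[X] →ₗ[ℝ] ℝ) (k : ℕ)

theorem awForm_add_left (f f' g : ℝ[X]) :
    awForm L k (f + f') g = awForm L k f g + awForm L k f' g := by
  simp [awForm, add_mul]

theorem awForm_add_right (f g g' : ℝ[X]) :
    awForm L k f (g + g') = awForm L k f g + awForm L k f g' := by
  simp [awForm, mul_add]

theorem awForm_C_mul_left (a : ℝ) (f g : ℝ[X]) :
    awForm L k (C a * f) g = a * awForm L k f g := by
  rw [awForm, ← smul_eq_C_mul, map_smul, smul_mul_assoc, map_smul, smul_eq_mul, awForm]

theorem awForm_C_mul_right (a : ℝ) (f g : ℝ[X]) :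
    awForm L k f (C a * g) = a * awForm L k f g := by
  rw [awForm, mul_left_comm, map_C_mul, awForm]

theorem awForm_X_sq_mul (f g : ℝ[X]) :
    awForm L k (X * (X * f)) g = 2 * node k * awForm L k (X * f) (X * g) +
      (1 - node k ^ 2) * awForm L k f g - awForm L k f (X * (X * g)) := by
  simp only [awForm, sievedAW_X_sq_mul]
  rw [← map_C_mul, ← map_C_mul, ← map_add, ← map_sub]
  congr 1
  ring

end awForm

namespace IsSymmOPS

variable {L : ℝ[X] →ₗ[ℝ] ℝ} {P : ℕ → ℝ[X]} {c : ℕ → ℝ} {k : ℕ}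

theorem awForm_eq_zero_of_le (h : IsSymmOPS L P c) {n j : ℕ} (hnj : n ≤ j) :
    awForm L k (P n) (P j) = 0 :=
  h.map_mul_eq_zero ((sievedAW_degree_lt k (h.natDegree_eq n).le).trans_le (by exact_mod_cast hnj))

/-- D_k reverses parity, so the product is an odd polynomial and a symmetric functional kills it. -/
theorem awForm_eq_zero_of_even (h : IsSymmOPS L P c) {n j : ℕ} (hnj : Even (n + j)) :
    awForm L k (P n) (P j) = 0 := by
  have h1 := h.symm (sievedAW k (P n) * P j)
  have h2 : (sievedAW k (P n)).comp (-X) = -(C ((-1) ^ n) * sievedAW k (P n)) := by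
    rw [← neg_eq_iff_eq_neg, ← sievedAW_comp_neg_X, h.isRecurrenceCoeff.comp_neg_X,
      ← smul_eq_C_mul, map_smul, smul_eq_C_mul]
  rw [mul_comp, h2, h.isRecurrenceCoeff.comp_neg_X] at h1
  have h3 : -(C ((-1) ^ n) * sievedAW k (P n)) * (C ((-1) ^ j) * P j) =
      C (-((-1) ^ (n + j))) * (sievedAW k (P n) * P j) := by
    rw [pow_add]; simp only [map_neg, map_mul]; ring
  rw [h3, map_C_mul, hnj.neg_one_pow] at h1
  rw [awForm]
  linarith

/-- The five-term relation between the Fourier coefficients of `D_k P_n`. -/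
theorem awForm_recurrence (h : IsSymmOPS L P c) (n j : ℕ) :
    (1 - c n) * (1 - c (n + 1)) * awForm L k (P (n + 2)) (P j) +
      ((1 - c n) * c (n + 1) + c n * (1 - c (n - 1))) * awForm L k (P n) (P j) +
      c n * c (n - 1) * awForm L k (P (n - 2)) (P j) =
    2 * node k * ((1 - c n) * ((1 - c j) * awForm L k (P (n + 1)) (P (j + 1)) +
        c j * awForm L k (P (n + 1)) (P (j - 1))) +
      c n * ((1 - c j) * awForm L k (P (n - 1)) (P (j + 1)) +
        c j * awForm L k (P (n - 1)) (P (j - 1)))) +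
    (1 - node k ^ 2) * awForm L k (P n) (P j) -
    ((1 - c j) * (1 - c (j + 1)) * awForm L k (P n) (P (j + 2)) +
      ((1 - c j) * c (j + 1) + c j * (1 - c (j - 1))) * awForm L k (P n) (P j) +
      c j * c (j - 1) * awForm L k (P n) (P (j - 2))) := by
  have hr := h.isRecurrenceCoeff
  have := awForm_X_sq_mul L k (P n) (P j)
  rw [hr.X_mul_X_mul, hr.X_mul_X_mul, hr.recurrence n, hr.recurrence j] at this
  simp only [awForm_add_left, awForm_add_right, awForm_C_mul_left, awForm_C_mul_right] at this
  linear_combination this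

end IsSymmOPS

/-! ### Coincidence of Fourier coefficients and the orthogonality and pointwise conditions -/

/-- The Fourier coefficients of `D_k P_n` of index below `n` and of the same parity coincide. -/
def ShiftInvariant (L : ℝ[X] →ₗ[ℝ] ℝ) (P : ℕ → ℝ[X]) (k n : ℕ) : Prop :=
  ∀ j, j + 2 ≤ n → awForm L k (P n) (P (j + 2)) = awForm L k (P n) (P j)

theorem ShiftInvariant.mul_pred {L : ℝ[X] →ₗ[ℝ] ℝ} {P : ℕ → ℝ[X]} {c : ℕ → ℝ} {k n : ℕ}
    (hs : ShiftInvariant L P k n) (hc : c 0 = 0) {j : ℕ} (hj : j + 1 ≤ n) :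
    c j * awForm L k (P n) (P (j - 1)) = c j * awForm L k (P n) (P (j + 1)) := by
  rcases j with _ | j
  · simp [hc]
  · rw [Nat.add_sub_cancel, hs j (by omega)]

theorem ShiftInvariant.mul_pred_two {L : ℝ[X] →ₗ[ℝ] ℝ} {P : ℕ → ℝ[X]} {c : ℕ → ℝ} {k n : ℕ}
    (hs : ShiftInvariant L P k n) (hc : c 0 = 0) {j : ℕ} (hj : j ≤ n) :
    c j * c (j - 1) * awForm L k (P n) (P (j - 2)) =
      c j * c (j - 1) * awForm L k (P n) (P j) := by
  rcases j with _ | _ | j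
  · simp [hc]
  · simp [hc]
  · rw [show j + 1 + 1 - 2 = j by omega, show j + 1 + 1 = j + 2 by omega, hs j (by omega)]

namespace IsSymmOPS

variable {L : ℝ[X] →ₗ[ℝ] ℝ} {P : ℕ → ℝ[X]} {c : ℕ → ℝ} {k : ℕ}

theorem map_one_sub_sq_mul (h : IsSymmOPS L P c) (n j : ℕ) :
    L ((1 - X ^ 2) * sievedAW k (P n) * P j) =
      (1 - c j) * (1 - c (j + 1)) * (awForm L k (P n) (P j) - awForm L k (P n) (P (j + 2))) -
      c j * c (j - 1) * (awForm L k (P n) (P (j - 2)) - awForm L k (P n) (P j)) := by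
  rw [mul_comm (1 - X ^ 2), mul_assoc, h.isRecurrenceCoeff.one_sub_X_sq_mul]
  simp only [awForm]
  rw [← map_sub, ← map_sub, ← map_C_mul, ← map_C_mul, ← map_sub]
  congr 1
  ring

/-- Moving 1 - x² onto P_j turns the orthogonality relation into one between consecutive differences
of κ_n. The lower difference has coefficient c_j c_{j-1}, which is 0 for j ≤ 1, so the differences
vanish one after another. -/
theorem orthogonal_iff_shiftInvariant (h : IsSymmOPS L P c) (n : ℕ) :
    (∀ j, j + 2 ≤ n → L ((1 - X ^ 2) * sievedAW k (P n) * P j) = 0) ↔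
      ShiftInvariant L P k n := by
  have hr := h.isRecurrenceCoeff
  constructor
  · intro ho j
    induction j using Nat.strong_induction_on with
    | _ j ih =>
      intro hj
      have h1 := ho j hj
      rw [h.map_one_sub_sq_mul] at h1
      have h2 : c j * c (j - 1) * (awForm L k (P n) (P (j - 2)) - awForm L k (P n) (P j)) = 0 := by
        rcases j with _ | _ | j
        · simp [hr.coeff_zero]
        · simp [hr.coeff_zero]
        · rw [show j + 1 + 1 - 2 = j by omega, show j + 1 + 1 = j + 2 by omega,
            ih j (by omega) (by omega)]
          simp
      rw [h2, sub_zero] at h1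
      have h3 := mul_pos (hr.one_sub_pos j) (hr.one_sub_pos (j + 1))
      linarith [(mul_eq_zero.1 h1).resolve_left h3.ne']
  · intro hs j hj
    have := hs.mul_pred_two hr.coeff_zero (j := j) (by omega)
    rw [h.map_one_sub_sq_mul, hs j hj]
    linear_combination -this

/-- On a function of the index that is constant along one parity, multiplying P_j by x or x² acts
trivially, since the expansion coefficients sum to 1. The right-hand side therefore no longer
involves the coefficients c_j. -/
theorem awForm_recurrence_of_shiftInvariant (h : IsSymmOPS L P c) {n j : ℕ}
    (h1 : ShiftInvariant L P k (n + 1)) (h2 : ShiftInvariant L P k n)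
    (h3 : ShiftInvariant L P k (n - 1)) (hj : j + 2 ≤ n) :
    (1 - c n) * (1 - c (n + 1)) * awForm L k (P (n + 2)) (P j) +
      ((1 - c n) * c (n + 1) + c n * (1 - c (n - 1))) * awForm L k (P n) (P j) +
      c n * c (n - 1) * awForm L k (P (n - 2)) (P j) =
    2 * node k * ((1 - c n) * awForm L k (P (n + 1)) (P (j + 1)) +
      c n * awForm L k (P (n - 1)) (P (j + 1))) - node k ^ 2 * awForm L k (P n) (P j) := by
  have hc := h.isRecurrenceCoeff.coeff_zero
  have e1 := h1.mul_pred hc (j := j) (by omega)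
  have e2 := h2.mul_pred_two hc (j := j) (by omega)
  have e3 := h3.mul_pred hc (j := j) (by omega)
  have e4 := h2 j hj
  have hone : (1 - c j) * c (j + 1) + c j * (1 - c (j - 1)) =
      1 - (1 - c j) * (1 - c (j + 1)) - c j * c (j - 1) := by ring
  rw [h.awForm_recurrence, e4, hone]
  linear_combination 2 * node k * (1 - c n) * e1 + 2 * node k * c n * e3 - e2

/-- The pointwise conditions on the Fourier coefficients imply all coincidences. -/
theorem shiftInvariant_of_pointwise (h : IsSymmOPS L P c)
    (hA : ∀ n, 1 ≤ n → awForm L k (P (n + 2)) (P (n - 1)) = awForm L k (P (n + 2)) (P (n + 1)))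
    (hB : ∀ n, 1 ≤ n → ∃ m, m ≤ (n - 1) / 2 ∧
      awForm L k (P (n + 4)) (P (n - 1 - 2 * m)) = awForm L k (P (n + 4)) (P (n + 3)))
    (N : ℕ) : ShiftInvariant L P k N := by
  have hr := h.isRecurrenceCoeff
  induction N using Nat.strong_induction_on with
  | _ N ih =>
    intro j hj
    by_cases hpar : Even (N + j)
    · rw [h.awForm_eq_zero_of_even hpar, h.awForm_eq_zero_of_even (by
        rw [← add_assoc]; exact hpar.add even_two)]
    have hpar' : (N + j) % 2 = 1 := Nat.odd_iff.1 (Nat.not_even_iff_odd.1 hpar)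
    have htop : ∀ n, n + 3 = N → awForm L k (P N) (P n) = awForm L k (P N) (P (n + 2)) := by
      rintro n rfl
      simpa using hA (n + 1) (by omega)
    by_cases hj3 : j + 3 = N
    · exact (htop j hj3).symm
    -- With N = n + 2, the relation at i and at i + 2 agrees in every term except the one with P_N,
    -- by the induction hypothesis; its coefficient is positive.
    have hstep : ∀ i, i + 7 ≤ N → awForm L k (P N) (P (i + 2)) = awForm L k (P N) (P i) := by
      intro i hi
      obtain ⟨n, rfl⟩ : ∃ n, N = n + 2 := ⟨N - 2, by omega⟩
      have r0 := h.awForm_recurrence_of_shiftInvariant (j := i) (ih (n + 1) (by omega))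
        (ih n (by omega)) (ih (n - 1) (by omega)) (by omega)
      have r1 := h.awForm_recurrence_of_shiftInvariant (j := i + 2) (ih (n + 1) (by omega))
        (ih n (by omega)) (ih (n - 1) (by omega)) (by omega)
      rw [ih n (by omega) i (by omega), ih (n - 2) (by omega) i (by omega),
        show i + 2 + 1 = i + 1 + 2 by ring, ih (n + 1) (by omega) (i + 1) (by omega),
        ih (n - 1) (by omega) (i + 1) (by omega), ← r0] at r1
      have hp := mul_pos (hr.one_sub_pos n) (hr.one_sub_pos (n + 1))
      refine mul_left_cancel₀ hp.ne' ?_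
      linear_combination r1
    have hconst : ∀ m i, i + 2 * m + 5 ≤ N →
        awForm L k (P N) (P (i + 2 * m)) = awForm L k (P N) (P i) := by
      intro m i hi
      induction m with
      | zero => rfl
      | succ m ihm =>
        rw [show i + 2 * (m + 1) = i + 2 * m + 2 by ring, hstep _ (by omega), ihm (by omega)]
    by_cases hj5 : j + 5 = N
    -- The only link still missing joins N - 5 to N - 3. All indices up to N - 5 already share one
    -- value, so a single coincidence of any of them with N - 1 closes the gap.
    · obtain ⟨m, hm, hm'⟩ := hB (j + 1) (by omega)
      subst hj5
      rw [show j + 1 - 1 - 2 * m = j - 2 * m by omega] at hm'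
      have e1 := hconst m (j - 2 * m) (by omega)
      rw [show j - 2 * m + 2 * m = j by omega] at e1
      have e2 := htop (j + 2) (by omega)
      rw [e1, e2]
      exact hm'.symm
    · exact hstep j (by omega)

end IsSymmOPS

/-! ### Sieved coefficients imply orthogonality -/

section SievedOperator

variable {P : ℕ → ℝ[X]} {c : ℕ → ℝ} {k : ℕ}

theorem C_weight_mul_sub (hr : IsRecurrenceCoeff P c)
    (hw : ∀ n : ℕ, weight k n * (2 * c n - 1) = 0) (n : ℕ) :
    C (weight k n) * (X * P n - P (n + 1)) = C (weight k n) * (P (n - 1) - X * P n) := by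
  have h1 := congrArg (C : ℝ → ℝ[X]) (hw n)
  have h2 := hr.recurrence n
  simp only [map_mul, map_sub, map_one, map_zero] at h1 h2
  rw [show (C (2 : ℝ) : ℝ[X]) = 2 from rfl] at h1
  linear_combination 2 * C (weight k n) * h2 + (P (n - 1) - P (n + 1)) * h1

/-- If the recurrence coefficients equal `1 / 2` wherever the weight of `D_k` does not vanish, then
`(1 - x²) D_k P_n` is a multiple of `P_{n - 1} - P_{n + 1}`. -/
theorem one_sub_X_sq_mul_sievedAW (hr : IsRecurrenceCoeff P c)
    (hw : ∀ n : ℕ, weight k n * (2 * c n - 1) = 0) (n : ℕ) :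
    (1 - X ^ 2) * sievedAW k (P n) = C (weight k n) * (X * P n - P (n + 1)) ∧
    sievedAW k (X * P n) = C (node k) * X * sievedAW k (P n) +
      C (weight k (n + 1) - node k * weight k n) * P n := by
  -- The second identity is carried along because the product rule needs D_k(xP_n), which D_k P_n
  -- alone does not determine.
  induction n using Nat.twoStepInduction with
  | zero =>
    simp [hr.zero_eq_one, sievedAW_one, weight_zero, sievedAW_X, weight_one]
  | one =>
    have h1 := C_weight_mul_sub hr hw 1
    rw [h1]
    have h2 := sievedAW_X_sq_mul k 1
    simp only [mul_one, sievedAW_one, mul_zero, add_zero] at h2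
    simp only [hr.one_eq_X, hr.zero_eq_one, Nat.sub_self, sievedAW_X, h2]
    have h3 : (C (2 : ℝ) : ℝ[X]) = 2 := rfl
    norm_num [weight_one, weight_two, h3]
    exact ⟨by ring, by ring⟩
  | more m h0 h1 =>
    obtain ⟨H0, K0⟩ := h0
    obtain ⟨H1, K1⟩ := h1
    have hrec := hr.recurrence (m + 1)
    have hD := congrArg (sievedAW k) hrec
    have hD2 := congrArg (fun p => sievedAW k (X * p)) hrec
    have hA : (C (1 - c (m + 1)) : ℝ[X]) ≠ 0 := C_ne_zero.2 (hr.one_sub_pos (m + 1)).ne'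
    have F1 := C_weight_mul_sub hr hw (m + 1)
    have F2 := C_weight_mul_sub hr hw (m + 2)
    have w2 : weight k ((m + 2 : ℕ) : ℤ) = 2 * node k * weight k ((m + 1 : ℕ) : ℤ) -
        weight k (m : ℤ) := by
      have := weight_add_one k ((m : ℤ) + 1)
      rw [add_sub_cancel_right] at this
      push_cast
      rw [← this]; congr 1
    have w3 : weight k ((m + 2 : ℕ) + 1 : ℤ) = 2 * node k * weight k ((m + 2 : ℕ) : ℤ) -
        weight k ((m + 1 : ℕ) : ℤ) := by
      rw [weight_add_one]; congr 2; push_cast; ring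
    have w1' : (((m + 1 : ℕ) : ℤ) + 1) = ((m + 2 : ℕ) : ℤ) := by push_cast; ring
    have w0' : ((m : ℤ) + 1) = ((m + 1 : ℕ) : ℤ) := by push_cast; ring
    have E := congrArg (C : ℝ → ℝ[X]) (hw (m + 1))
    have hX := sievedAW_X_sq_mul k (P (m + 1))
    simp only [mul_add, mul_smul_comm, ← smul_eq_C_mul, map_add, map_smul] at hD hD2
    simp only [smul_eq_C_mul, Nat.add_sub_cancel] at hD hD2 hrec F1 F2
    rw [show m + 1 + 1 = m + 2 from rfl] at *
    rw [show m + 2 - 1 = m + 1 by omega] at F2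
    rw [w1'] at K1
    rw [w0'] at K0
    rw [F2, w3]
    rw [w2] at K1 ⊢
    simp only [map_mul, map_sub, map_one, map_zero, map_pow] at *
    rw [show (C (2 : ℝ) : ℝ[X]) = 2 from rfl] at *
    generalize sievedAW k (X * P (m + 2)) = Dx2 at *
    generalize sievedAW k (X * (X * P (m + 1))) = Dxx at *
    generalize sievedAW k (X * P (m + 1)) = Dx1 at *
    generalize sievedAW k (X * P m) = Dx0 at *
    generalize sievedAW k (P (m + 2)) = D2 at *
    generalize sievedAW k (P (m + 1)) = D1 at *
    generalize sievedAW k (P m) = D0 at *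
    generalize (C (weight k (m + 1 : ℕ)) : ℝ[X]) = u1 at *
    generalize (C (weight k m) : ℝ[X]) = u0 at *
    generalize (C (node k) : ℝ[X]) = g at *
    generalize (C (c (m + 1)) : ℝ[X]) = d at *
    generalize P (m + 2) = p2 at *
    generalize P (m + 1) = p1 at *
    generalize P m = p0 at *
    -- Apply D_k to the recurrence at m + 1 and insert `K1` for D_k(xP_{m+1}); `E` removes the
    -- coefficient c_{m+1}. The second identity arises likewise from x times the recurrence and the
    -- product rule `hX`.
    have hfirst : (1 - X ^ 2) * D2 = (2 * g * u1 - u0) * (p1 - X * p2) := by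
      refine mul_left_cancel₀ hA ?_
      linear_combination -(1 - X ^ 2) * hD + (1 - X ^ 2) * K1 + g * X * (H1 + F1) - d * H0 -
        (2 * g * u1 - u0) * X * hrec + g * (p1 - X * p0) * E
    refine ⟨hfirst, ?_⟩
    refine mul_left_cancel₀ hA ?_
    linear_combination hX - hD2 + g * X * hD + g * X * K1 - d * K0 + (1 - g ^ 2) * H1 +
      ((1 - g ^ 2) * u1 + g * (g * u1 - u0)) * hrec - (1 - g ^ 2) * p2 * E

theorem weight_mul_eq_zero_iff (hk : 2 ≤ k) :
    (∀ n : ℕ, weight k n * (2 * c n - 1) = 0) ↔ ∀ n, ¬ k ∣ n → c n = 1 / 2 := by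
  refine forall_congr' fun n => ?_
  rw [mul_eq_zero, weight_eq_zero_iff hk, or_iff_not_imp_left]
  exact imp_congr_right fun _ => ⟨fun h => by linarith, fun h => by linarith⟩

end SievedOperator

namespace IsSymmOPS

variable {L : ℝ[X] →ₗ[ℝ] ℝ} {P : ℕ → ℝ[X]} {c : ℕ → ℝ} {k : ℕ}

theorem orthogonal_of_weight_mul_eq_zero (h : IsSymmOPS L P c)
    (hw : ∀ n : ℕ, weight k n * (2 * c n - 1) = 0) {n j : ℕ} (hj : j + 2 ≤ n) :
    L ((1 - X ^ 2) * sievedAW k (P n) * P j) = 0 := by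
  have hr := h.isRecurrenceCoeff
  have e : C (weight k n) * (X * P n - P (n + 1)) * P j =
      C (weight k n * (1 - c n)) * (P (n + 1) * P j) +
      C (weight k n * c n) * (P (n - 1) * P j) - C (weight k n) * (P (n + 1) * P j) := by
    rw [hr.recurrence n]
    simp only [map_mul, map_sub]
    ring
  rw [(one_sub_X_sq_mul_sievedAW hr hw n).1, e, map_sub, map_add, map_C_mul, map_C_mul, map_C_mul,
    h.orthogonal _ _ (by omega), h.orthogonal _ _ (by omega)]
  simp

/-! ### Coincidences imply sieved coefficients -/

/-- Evaluate L(xP_nP_{n+1}) by expanding either xP_n or xP_{n+1}. -/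
theorem norm_succ (h : IsSymmOPS L P c) (n : ℕ) :
    c (n + 1) * L (P n * P n) = (1 - c n) * L (P (n + 1) * P (n + 1)) := by
  have hr := h.isRecurrenceCoeff
  have h1 : X * P n * P (n + 1) =
      C (1 - c n) * (P (n + 1) * P (n + 1)) + C (c n) * (P (n - 1) * P (n + 1)) := by
    rw [hr.recurrence n]; ring
  have h2 : X * P n * P (n + 1) =
      C (1 - c (n + 1)) * (P n * P (n + 2)) + C (c (n + 1)) * (P n * P n) := by
    rw [mul_comm X, mul_assoc, hr.recurrence (n + 1), Nat.add_sub_cancel]; ring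
  have h3 := congrArg L (h1.symm.trans h2)
  simp only [map_add, map_C_mul] at h3
  rw [h.orthogonal (n - 1) (n + 1) (by omega), h.orthogonal n (n + 2) (by omega)] at h3
  linarith

theorem norm_pos (h : IsSymmOPS L P c) (n : ℕ) : 0 < L (P n * P n) := by
  have hr := h.isRecurrenceCoeff
  induction n with
  | zero => rw [hr.zero_eq_one, mul_one, h.map_one]; exact one_pos
  | succ n ih =>
    have h1 := mul_pos (hr.pos n) ih
    rw [h.norm_succ] at h1
    exact pos_of_mul_pos_right h1 (hr.one_sub_pos n).le

/-- The leading Fourier coefficient of `D_k P_n`. -/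
theorem coeff_mul_awForm_pred (h : IsSymmOPS L P c) (n : ℕ) :
    c n * awForm L k (P n) (P (n - 1)) = weight k n * L (P n * P n) := by
  have hr := h.isRecurrenceCoeff
  induction n using Nat.twoStepInduction with
  | zero => simp [hr.coeff_zero, weight_zero]
  | one =>
    have h1 := h.norm_succ 0
    simp only [hr.coeff_zero, hr.zero_eq_one, mul_one, h.map_one, sub_zero, one_mul,
      zero_add] at h1
    rw [← h1, awForm, Nat.sub_self, hr.one_eq_X, sievedAW_X, hr.zero_eq_one, mul_one, h.map_one]
    simp [weight_one]
  | more n h0 h1 =>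
    -- At j = n + 1 only κ_{n+2}(n+1), κ_{n+1}(n) and κ_n(n-1) survive, and what remains mirrors the
    -- recurrence of the weights.
    have h2 := h.awForm_recurrence (k := k) n (n + 1)
    rw [h.awForm_eq_zero_of_le (show n ≤ n + 1 by omega),
      h.awForm_eq_zero_of_le (show n - 2 ≤ n + 1 by omega),
      h.awForm_eq_zero_of_le (show n + 1 ≤ n + 1 + 1 by omega),
      h.awForm_eq_zero_of_le (show n - 1 ≤ n + 1 + 1 by omega),
      h.awForm_eq_zero_of_le (show n - 1 ≤ n + 1 - 1 by omega),
      h.awForm_eq_zero_of_le (show n ≤ n + 1 + 2 by omega),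
      show n + 1 - 2 = n - 1 by omega, Nat.add_sub_cancel] at h2
    rw [Nat.add_sub_cancel] at h1
    rw [show n + 2 - 1 = n + 1 by omega]
    have hw : weight k ((n + 2 : ℕ) : ℤ) = 2 * node k * weight k ((n + 1 : ℕ) : ℤ) -
        weight k (n : ℤ) := by
      have := weight_add_one k ((n : ℤ) + 1)
      rw [add_sub_cancel_right] at this
      push_cast
      rw [← this]; congr 1
    have n0 := h.norm_succ n
    have n1 := h.norm_succ (n + 1)
    rw [show n + 1 + 1 = n + 2 from rfl] at n1
    refine mul_left_cancel₀ (mul_pos (hr.one_sub_pos n) (hr.one_sub_pos (n + 1))).ne' ?_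
    rw [hw]
    linear_combination c (n + 2) * h2 + 2 * node k * (1 - c n) * c (n + 2) * h1 -
      c (n + 2) * c (n + 1) * h0 - c (n + 2) * weight k n * n0 +
      (1 - c n) * (2 * node k * weight k ((n + 1 : ℕ) : ℤ) - weight k n) * n1

/-- Compare the five-term relation for n = m + 3 at j = m and at j = m + 2. After the coincidences,
the terms with P_{m+5} and P_{m+4} agree and cancel; near the diagonal some coefficients vanish only
at j = m + 2, so a nontrivial relation remains. -/
theorem awForm_three_term (h : IsSymmOPS L P c) (hs : ∀ n, ShiftInvariant L P k n) (m : ℕ) :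
    c (m + 3) * c (m + 2) * awForm L k (P (m + 1)) (P m) =
      2 * node k * c (m + 3) * (1 - c (m + 2)) * awForm L k (P (m + 2)) (P (m + 1)) -
      (1 - c (m + 2)) * (1 - c (m + 3)) * awForm L k (P (m + 3)) (P (m + 2)) := by
  have r1 := h.awForm_recurrence_of_shiftInvariant (n := m + 3) (j := m) (hs _) (hs _) (hs _)
    (by omega)
  have r2 := h.awForm_recurrence (k := k) (m + 3) (m + 2)
  simp only [show m + 3 + 2 = m + 5 from rfl, show m + 3 + 1 = m + 4 from rfl,
    show m + 3 - 1 = m + 2 from rfl, show m + 3 - 2 = m + 1 from rfl,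
    show m + 2 + 1 = m + 3 from rfl, show m + 2 - 1 = m + 1 from rfl,
    show m + 2 - 2 = m from by omega] at r1 r2
  rw [h.awForm_eq_zero_of_le (show m + 1 ≤ m + 2 by omega),
    h.awForm_eq_zero_of_le (show m + 2 ≤ m + 3 by omega),
    h.awForm_eq_zero_of_le (show m + 3 ≤ m + 4 by omega)] at r2
  have s1 := hs (m + 5) m (by omega)
  have s2 := hs (m + 4) (m + 1) (by omega)
  have s3 := hs (m + 3) m (by omega)
  rw [show m + 1 + 2 = m + 3 from rfl] at s2
  rw [← s1, ← s3] at r1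
  rw [← s3] at r2
  rw [← s2] at r1 r2
  linear_combination r1 - r2

/-- The ratios `w_n (1 - c_n) / c_n` satisfy the recurrence relation of the weights. -/
theorem weight_ratio_recurrence (h : IsSymmOPS L P c) (hs : ∀ n, ShiftInvariant L P k n) (m : ℕ) :
    weight k ((m + 3 : ℕ) : ℤ) * ((1 - c (m + 3)) / c (m + 3)) =
      2 * node k * (weight k ((m + 2 : ℕ) : ℤ) * ((1 - c (m + 2)) / c (m + 2))) -
        weight k ((m + 1 : ℕ) : ℤ) * ((1 - c (m + 1)) / c (m + 1)) := by
  have hr := h.isRecurrenceCoeff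
  have h3 := h.awForm_three_term hs m
  have e1 := h.coeff_mul_awForm_pred (k := k) (m + 1)
  have e2 := h.coeff_mul_awForm_pred (k := k) (m + 2)
  have e3 := h.coeff_mul_awForm_pred (k := k) (m + 3)
  rw [show m + 1 - 1 = m from rfl] at e1
  rw [show m + 2 - 1 = m + 1 from rfl] at e2
  rw [show m + 3 - 1 = m + 2 from rfl] at e3
  have n1 := h.norm_succ (m + 1)
  have n2 := h.norm_succ (m + 2)
  simp only [show m + 2 + 1 = m + 3 from rfl, show m + 1 + 1 = m + 2 from rfl] at n1 n2
  have p1 : c (m + 1) ≠ 0 := (hr.pos m).ne'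
  have p2 : c (m + 2) ≠ 0 := (hr.pos (m + 1)).ne'
  have p3 : c (m + 3) ≠ 0 := (hr.pos (m + 2)).ne'
  have g2 := (h.norm_pos (m + 2)).ne'
  have f1 := eq_div_of_mul_eq p1 ((mul_comm _ _).trans e1)
  have f2 := eq_div_of_mul_eq p2 ((mul_comm _ _).trans e2)
  have f3 := eq_div_of_mul_eq p3 ((mul_comm _ _).trans e3)
  rw [f1, f2, f3] at h3
  have t1 : c (m + 3) * c (m + 2) * (weight k ((m + 1 : ℕ) : ℤ) * L (P (m + 1) * P (m + 1)) /
      c (m + 1)) = c (m + 3) * L (P (m + 2) * P (m + 2)) *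
        (weight k ((m + 1 : ℕ) : ℤ) * ((1 - c (m + 1)) / c (m + 1))) := by
    field_simp
    linear_combination weight k ((m + 1 : ℕ) : ℤ) * n1
  have t3 : (1 - c (m + 2)) * (1 - c (m + 3)) * (weight k ((m + 3 : ℕ) : ℤ) *
      L (P (m + 3) * P (m + 3)) / c (m + 3)) = c (m + 3) * L (P (m + 2) * P (m + 2)) *
        (weight k ((m + 3 : ℕ) : ℤ) * ((1 - c (m + 3)) / c (m + 3))) := by
    have : (1 - c (m + 2)) * L (P (m + 3) * P (m + 3)) / c (m + 3) =
        L (P (m + 2) * P (m + 2)) := by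
      rw [div_eq_iff p3]; linarith
    rw [← this]
    field_simp
  rw [t1, t3] at h3
  refine mul_left_cancel₀ (mul_ne_zero p3 g2) ?_
  linear_combination h3

/-- This is the five-term relation at n = 1, j = 0, with κ_3(0) replaced by κ_3(2) and the leading
coefficients κ_n(n-1) made explicit. The ratio recurrence starts at index 1 and cannot fix c_1, so
this supplies the missing equation. -/
theorem initial_relation (h : IsSymmOPS L P c) (hs : ShiftInvariant L P k 3) :
    (4 * node k ^ 2 - 1) * (c 1 * c 2) + (1 - c 1) * c 2 + c 1 =
      4 * node k ^ 2 * c 1 + 1 - node k ^ 2 - c 1 := by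
  have hr := h.isRecurrenceCoeff
  have r := h.awForm_recurrence (k := k) 1 0
  have e1 := h.coeff_mul_awForm_pred (k := k) 1
  have e2 := h.coeff_mul_awForm_pred (k := k) 2
  have e3 := h.coeff_mul_awForm_pred (k := k) 3
  have n0 := h.norm_succ 0
  have n1 := h.norm_succ 1
  have n2 := h.norm_succ 2
  have s := hs 0 (by omega)
  have z : awForm L k (P 0) (P 1) = 0 := h.awForm_eq_zero_of_le (by omega)
  rw [hr.zero_eq_one] at z
  have z' : awForm L k (P 1) (P 2) = 0 := h.awForm_eq_zero_of_le (by omega)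
  norm_num [hr.coeff_zero, weight_one, weight_two, weight_three, z, z', hr.zero_eq_one,
    h.map_one] at r e1 e2 e3 n0 n1 n2 s
  have p1 : c 1 ≠ 0 := (hr.pos 0).ne'
  have p2 : c 2 ≠ 0 := (hr.pos 1).ne'
  have p3 : c 3 ≠ 0 := (hr.pos 2).ne'
  rw [← n0] at e1 n1
  have f1 : awForm L k (P 1) 1 = 1 := mul_left_cancel₀ p1 (by linarith)
  have f2 : (1 - c 1) * awForm L k (P 2) (P 1) = 2 * node k * c 1 := by
    refine mul_left_cancel₀ p2 ?_
    linear_combination (1 - c 1) * e2 - 2 * node k * n1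
  have f3 : (1 - c 1) * (1 - c 2) * awForm L k (P 3) 1 = (4 * node k ^ 2 - 1) * (c 1 * c 2) := by
    refine mul_left_cancel₀ p3 ?_
    rw [← s]
    linear_combination (1 - c 1) * (1 - c 2) * e3 - (1 - c 1) * (4 * node k ^ 2 - 1) * n2 -
      c 3 * (4 * node k ^ 2 - 1) * n1
  rw [f1, f3] at r
  linear_combination r + 2 * node k * f2

/-- If all Fourier coefficients of `D_k P_n` coincide, then the recurrence coefficients are those
of a `k`-sieved sequence. -/
theorem coeff_eq_half (h : IsSymmOPS L P c) (hk : 2 ≤ k) (hs : ∀ n, ShiftInvariant L P k n)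
    {n : ℕ} (hn : ¬ k ∣ n) : c n = 1 / 2 := by
  have hr := h.isRecurrenceCoeff
  -- Subtracting a multiple of w_n makes v_1 = 0 without spoiling the recurrence, so v_{m+1} = v_2
  -- w_m. Then v_k = 0 and w_{k-1} = 1 give v_2 = 0.
  set v : ℕ → ℝ := fun n => weight k n * ((1 - c n) / c n - (1 - c 1) / c 1) with hv
  have hw : ∀ m : ℕ, weight k ((m + 3 : ℕ) : ℤ) = 2 * node k * weight k ((m + 2 : ℕ) : ℤ) -
      weight k ((m + 1 : ℕ) : ℤ) := by
    intro m
    have := weight_add_one k ((m + 2 : ℕ) : ℤ)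
    rw [show ((m + 2 : ℕ) : ℤ) - 1 = ((m + 1 : ℕ) : ℤ) by push_cast; ring] at this
    rw [← this]; congr 1
  have hvrec : ∀ m, v (m + 3) = 2 * node k * v (m + 2) - v (m + 1) := by
    intro m
    have := h.weight_ratio_recurrence hs m
    simp only [hv]
    linear_combination this - ((1 - c 1) / c 1) * hw m
  have hvw : ∀ m, v (m + 1) = v 2 * weight k m := by
    intro m
    induction m using Nat.strong_induction_on with
    | _ m ih =>
      rcases m with _ | _ | m
      · simp [hv, weight_zero]
      · simp [weight_one]
      · have e0 := ih m (by omega)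
        have e1 := ih (m + 1) (by omega)
        have := weight_add_one k ((m + 1 : ℕ) : ℤ)
        rw [show ((m + 1 : ℕ) : ℤ) - 1 = (m : ℤ) by push_cast; ring] at this
        rw [show m + 1 + 1 + 1 = m + 3 from rfl, hvrec m, e0, show m + 2 = m + 1 + 1 from rfl, e1,
          show ((m + 1 + 1 : ℕ) : ℤ) = ((m + 1 : ℕ) : ℤ) + 1 by push_cast; ring, this]
        ring
  have hv2 : v 2 = 0 := by
    have h1 := hvw (k - 1)
    rw [show k - 1 + 1 = k by omega, show ((k - 1 : ℕ) : ℤ) = (k : ℤ) - 1 by omega,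
      weight_sub_one hk, mul_one] at h1
    rw [← h1, hv]
    simp only
    rw [(weight_eq_zero_iff hk k).2 dvd_rfl, zero_mul]
  have hc : ∀ m, ¬ k ∣ m → c m = c 1 := by
    intro m hm
    obtain ⟨m, rfl⟩ : ∃ l, m = l + 1 := ⟨m - 1, by
      have : m ≠ 0 := by rintro rfl; exact hm (dvd_zero k)
      omega⟩
    have h1 := hvw m
    rw [hv2, zero_mul] at h1
    have h2 := (mul_eq_zero.1 h1).resolve_left fun h0 => hm ((weight_eq_zero_iff hk _).1 h0)
    have p1 : c 1 ≠ 0 := (hr.pos 0).ne'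
    have pm : c (m + 1) ≠ 0 := (hr.pos m).ne'
    field_simp at h2
    linarith
  rw [hc n hn]
  have h0 := h.initial_relation (hs 3)
  -- For k = 2 the value c_2 is unconstrained, but γ = 0 lets 1 - c_2 factor out; for k ≥ 3 one has
  -- c_2 = c_1. In both cases 1 - 2c_1 splits off with a positive cofactor.
  rcases hk.eq_or_lt with rfl | hk3
  · have hg : node 2 = 0 := by
      have h1 := (weight_eq_zero_iff le_rfl 2).2 dvd_rfl
      have h2 := weight_two 2
      rw [Nat.cast_ofNat] at h1
      linarith
    rw [hg] at h0
    have h1 : (1 - 2 * c 1) * (1 - c 2) = 0 := by linear_combination -h0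
    have := (mul_eq_zero.1 h1).resolve_right (hr.one_sub_pos 2).ne'
    linarith
  · rw [hc 2 fun hd => by have := Nat.le_of_dvd two_pos hd; omega] at h0
    have h1 : (1 - 2 * c 1) * ((1 - node k ^ 2) * (1 - c 1) + node k ^ 2 * c 1) = 0 := by
      linear_combination -h0
    have h2 : 0 < (1 - node k ^ 2) * (1 - c 1) + node k ^ 2 * c 1 :=
      add_pos_of_pos_of_nonneg (mul_pos (by linarith [node_sq_lt_one hk]) (hr.one_sub_pos 1))
        (mul_nonneg (sq_nonneg _) (hr.pos 0).le)
    have := (mul_eq_zero.1 h1).resolve_right h2.ne'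
    linarith

end IsSymmOPS

/-! ### Existence of the recurrence coefficients and of P* -/

theorem C_div_eq (a b : ℝ) : (C (a / b) : ℝ[X]) = C (1 / b) * C a := by
  rw [← C_mul]; congr 1; ring

namespace IsOPS

variable {L : ℝ[X] →ₗ[ℝ] ℝ} {P : ℕ → ℝ[X]}

theorem exists_three_term (h : IsOPS L P) (hL : IsPosDef L)
    (hs : ∀ p, L (p.comp (-X)) = L p) :
    ∃ a c : ℕ → ℝ, c 0 = 0 ∧ ∀ n, X * P n = C (a n) * P (n + 1) + C (c n) * P (n - 1) := by
  have hg : ∀ n, L (P n * P n) ≠ 0 := fun n => (hL _ (h.ne_zero n)).ne'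
  have hd : ∀ {j n : ℕ}, j + 1 < n → L (X * P j * P n) = 0 := fun {j n} hj =>
    h.map_mul_eq_zero (by
      rw [degree_mul, degree_X, h.degree_eq]
      norm_cast
      omega)
  refine ⟨fun n => L (X * P n * P (n + 1)) / L (P (n + 1) * P (n + 1)),
    fun n => if n = 0 then 0 else L (X * P n * P (n - 1)) / L (P (n - 1) * P (n - 1)),
    by simp, fun n => ?_⟩
  set a := L (X * P n * P (n + 1)) / L (P (n + 1) * P (n + 1)) with ha
  set c := if n = 0 then 0 else L (X * P n * P (n - 1)) / L (P (n - 1) * P (n - 1)) with hc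
  rw [← sub_eq_zero]
  refine h.eq_zero_of_forall hL (n := n + 2) ?_ fun j hj => ?_
  · have hC : ∀ (b : ℝ) (m : ℕ), m < n + 2 → (C b * P m).degree < (n + 2 : ℕ) := fun b m hm => by
      rw [← smul_eq_C_mul]
      exact (degree_smul_le _ _).trans_lt ((h.degree_eq m).trans_lt (by exact_mod_cast hm))
    refine (degree_sub_le _ _).trans_lt (max_lt ?_ ((degree_add_le _ _).trans_lt
      (max_lt (hC _ _ (by omega)) (hC _ _ (by omega)))))
    rw [degree_mul, degree_X, h.degree_eq]
    norm_cast
    omega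
  · rw [sub_mul, add_mul, map_sub, map_add, mul_assoc (C a), mul_assoc (C c), map_C_mul, map_C_mul]
    rcases lt_trichotomy j n with hlt | rfl | hgt
    · rw [h.orthogonal (n + 1) j (by omega)]
      obtain ⟨m, rfl⟩ : ∃ m, n = m + 1 := ⟨n - 1, by omega⟩
      rw [Nat.add_sub_cancel] at hc ⊢
      rcases (Nat.lt_succ_iff.1 hlt).eq_or_lt with rfl | hlt'
      · rw [hc, if_neg (by omega), div_mul_cancel₀ _ (hg _)]
        ring
      · rw [show X * P (m + 1) * P j = X * P j * P (m + 1) by ring, hd (by omega),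
          h.orthogonal m j hlt'.ne']
        ring
    -- The diagonal coefficient vanishes because x P_j² is odd.
    · have h1 : L (X * P j * P j) = 0 := by
        have h2 := hs (X * P j * P j)
        rw [mul_comp, mul_comp, h.comp_neg_X hL hs, X_comp] at h2
        have h3 : -X * (C ((-1) ^ j) * P j) * (C ((-1) ^ j) * P j) =
            C (-((-1) ^ j * (-1) ^ j)) * (X * P j * P j) := by
          simp only [map_neg, map_mul]; ring
        rw [h3, map_C_mul, ← mul_pow] at h2
        norm_num at h2
        linarith
      rw [h1, h.orthogonal (j + 1) j (by omega)]
      rcases j with _ | j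
      · simp [hc]
      · rw [h.orthogonal (j + 1 - 1) (j + 1) (by omega)]
        ring
    · obtain rfl : j = n + 1 := by omega
      rw [ha, div_mul_cancel₀ _ (hg _), h.orthogonal (n - 1) (n + 1) (by omega)]
      ring

/-- Existence of the recurrence coefficients. -/
theorem exists_isRecurrenceCoeff (h : IsOPS L P) (hL : IsPosDef L)
    (hs : ∀ p, L (p.comp (-X)) = L p) (hL1 : ∀ p, p ≠ 0 → 0 < L ((1 - X) * (p * p))) :
    ∃ c, IsRecurrenceCoeff P c := by
  obtain ⟨a, c, hc0, hr⟩ := h.exists_three_term hL hs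
  have hg : ∀ n, 0 < L (P n * P n) := fun n => hL _ (h.ne_zero n)
  have hac : ∀ n, a n + c n = 1 := fun n => by
    simpa [h.eval_one] using (congrArg (eval 1) (hr n)).symm
  have hnorm : ∀ n, c (n + 1) * L (P n * P n) = a n * L (P (n + 1) * P (n + 1)) := by
    intro n
    have h1 : X * P n * P (n + 1) =
        C (a n) * (P (n + 1) * P (n + 1)) + C (c n) * (P (n - 1) * P (n + 1)) := by
      rw [hr n]; ring
    have h2 : X * P n * P (n + 1) =
        C (a (n + 1)) * (P n * P (n + 2)) + C (c (n + 1)) * (P n * P n) := by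
      rw [mul_comm X, mul_assoc, hr (n + 1), Nat.add_sub_cancel]; ring
    have h3 := congrArg L (h1.symm.trans h2)
    simp only [map_add, map_C_mul] at h3
    rw [h.orthogonal (n - 1) (n + 1) (by omega), h.orthogonal n (n + 2) (by omega)] at h3
    linarith
  -- The Christoffel–Darboux kernel at the point 1. It satisfies L((1 - x)S_n²) = a_n / L(P_n²), so
  -- positivity of 1 - x on the support yields a_n > 0.
  set S : ℕ → ℝ[X] := fun n => ∑ j ∈ Finset.range (n + 1), C (1 / L (P j * P j)) * P j with hS
  have hker : ∀ n, (1 - X) * S n = C (a n / L (P n * P n)) * (P n - P (n + 1)) := by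
    intro n
    induction n with
    | zero =>
      have h0 := hr 0
      have h1 := hac 0
      rw [hc0, add_zero] at h1
      rw [hc0, h1] at h0
      simp only [hS, Finset.sum_range_one, zero_add, h1]
      simp only [map_one, one_mul, map_zero, zero_mul, add_zero, zero_add] at h0
      rw [← h0]; ring
    | succ n ih =>
      have e : S (n + 1) = S n + C (1 / L (P (n + 1) * P (n + 1))) * P (n + 1) := by
        simp only [hS]; rw [Finset.sum_range_succ]
      have hn : a n / L (P n * P n) = 1 / L (P (n + 1) * P (n + 1)) * c (n + 1) := by
        have := hnorm n
        have g0 := (hg n).ne'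
        have g1 := (hg (n + 1)).ne'
        field_simp
        linarith
      have hrn := hr (n + 1)
      have h1 := congrArg (C : ℝ → ℝ[X]) (hac (n + 1))
      rw [Nat.add_sub_cancel] at hrn
      rw [e, mul_add, ih, hn, C_div_eq (a (n + 1))]
      simp only [map_mul, map_add, map_one] at h1 ⊢
      linear_combination -C (1 / L (P (n + 1) * P (n + 1))) * hrn -
        C (1 / L (P (n + 1) * P (n + 1))) * P (n + 1) * h1
  have ha : ∀ n, 0 < a n := by
    intro n
    have h1 : ∀ m, L (P m * S n) = if m ≤ n then 1 else 0 := by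
      intro m
      simp only [hS, Finset.mul_sum, map_sum, mul_left_comm (P m), map_C_mul]
      split_ifs with hm
      · rw [Finset.sum_eq_single_of_mem m (Finset.mem_range.2 (by omega))
          fun j _ hj => by rw [h.orthogonal m j hj.symm, mul_zero]]
        exact one_div_mul_cancel (hg m).ne'
      · refine Finset.sum_eq_zero fun j hj => ?_
        have := Finset.mem_range.1 hj
        rw [h.orthogonal m j (by omega), mul_zero]
    have h2 : S n ≠ 0 := by
      intro h0
      have := h1 n
      simp [h0] at this
    have h3 := hL1 _ h2
    rw [← mul_assoc, hker, mul_assoc, map_C_mul, sub_mul, map_sub, h1, h1, if_pos le_rfl,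
      if_neg (by omega), sub_zero, mul_one] at h3
    exact (div_pos_iff_of_pos_right (hg n)).1 h3
  refine ⟨c, h.zero_eq_one, hc0, fun n hn => ⟨?_, by linarith [hac n, ha n]⟩, fun n => ?_⟩
  · obtain ⟨m, rfl⟩ : ∃ m, n = m + 1 := ⟨n - 1, by omega⟩
    have h1 := mul_pos (ha m) (hg (m + 1))
    rw [← hnorm] at h1
    exact pos_of_mul_pos_left h1 (hg m).le
  · rw [show 1 - c n = a n by linarith [hac n]]
    exact hr n

end IsOPS

/-- The functional `p ↦ L ((1 - x²) p)`. -/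
noncomputable def starFunctional (L : ℝ[X] →ₗ[ℝ] ℝ) : ℝ[X] →ₗ[ℝ] ℝ :=
  L.comp (LinearMap.mulLeft ℝ (1 - X ^ 2))

theorem starFunctional_apply (L : ℝ[X] →ₗ[ℝ] ℝ) (p : ℝ[X]) :
    starFunctional L p = L ((1 - X ^ 2) * p) := rfl

namespace IsSymmOPS

variable {L : ℝ[X] →ₗ[ℝ] ℝ} {P Q : ℕ → ℝ[X]} {c : ℕ → ℝ} {k : ℕ}

/-- The kernel polynomials of `P`, restricted to indices of equal parity. -/
noncomputable def parityKernel (L : ℝ[X] →ₗ[ℝ] ℝ) (P : ℕ → ℝ[X]) : ℕ → ℝ[X]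
  | 0 => C (1 / L (P 0 * P 0)) * P 0
  | 1 => C (1 / L (P 1 * P 1)) * P 1
  | n + 2 => parityKernel L P n + C (1 / L (P (n + 2) * P (n + 2))) * P (n + 2)

/-- The differences produced by (1 - x²)P_j telescope, because `norm_succ` matches the coefficients
of neighbouring terms. Orthogonality of the kernels under (1 - x²)dμ can then be read off from P_n -
P_{n+2}. -/
theorem one_sub_X_sq_mul_parityKernel (h : IsSymmOPS L P c) (n : ℕ) :
    (1 - X ^ 2) * parityKernel L P n =
      C ((1 - c n) * (1 - c (n + 1)) / L (P n * P n)) * (P n - P (n + 2)) := by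
  have hr := h.isRecurrenceCoeff
  induction n using Nat.twoStepInduction with
  | zero =>
    rw [parityKernel, mul_left_comm, hr.one_sub_X_sq_mul, hr.coeff_zero, C_div_eq (_ * _)]
    simp only [map_mul, zero_mul, map_zero]
    ring
  | one =>
    rw [parityKernel, mul_left_comm, hr.one_sub_X_sq_mul, Nat.sub_self, hr.coeff_zero,
      C_div_eq (_ * _)]
    simp only [map_mul, mul_zero, map_zero]
    ring
  | more n h0 _ =>
    have n0 := h.norm_succ n
    have n1 := h.norm_succ (n + 1)
    have g0 := (h.norm_pos n).ne'
    have g1 := (h.norm_pos (n + 1)).ne'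
    have g2 := (h.norm_pos (n + 2)).ne'
    have e : (1 - c n) * (1 - c (n + 1)) / L (P n * P n) =
        1 / L (P (n + 2) * P (n + 2)) * (c (n + 2) * c (n + 1)) := by
      rw [show n + 1 + 1 = n + 2 from rfl] at n1
      field_simp
      refine mul_left_cancel₀ g1 ?_
      linear_combination (-c (n + 2) * L (P (n + 1) * P (n + 1))) * n0 -
        ((1 - c n) * L (P (n + 1) * P (n + 1))) * n1
    rw [parityKernel, mul_add, h0, mul_left_comm, hr.one_sub_X_sq_mul, e,
      show n + 2 - 1 = n + 1 from rfl, show n + 2 - 2 = n from rfl,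
      C_div_eq ((1 - c (n + 2)) * _)]
    simp only [map_mul]
    ring

theorem natDegree_parityKernel (h : IsSymmOPS L P c) (n : ℕ) :
    (parityKernel L P n).natDegree = n := by
  have hC : ∀ n, (C (1 / L (P n * P n)) * P n).natDegree = n := fun n => by
    rw [natDegree_C_mul (one_div_pos.2 (h.norm_pos n)).ne', h.natDegree_eq]
  induction n using Nat.twoStepInduction with
  | zero => exact hC 0
  | one => exact hC 1
  | more n h0 _ =>
    rw [parityKernel, natDegree_add_eq_right_of_natDegree_lt, hC]
    rw [hC, h0]
    omega

theorem eval_one_parityKernel (h : IsSymmOPS L P c) (n : ℕ) :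
    0 < (parityKernel L P n).eval 1 := by
  have hC : ∀ n, 0 < (C (1 / L (P n * P n)) * P n).eval 1 := fun n => by
    rw [eval_mul, eval_C, h.eval_one, mul_one]
    exact one_div_pos.2 (h.norm_pos n)
  induction n using Nat.twoStepInduction with
  | zero => exact hC 0
  | one => exact hC 1
  | more n h0 _ =>
    rw [parityKernel, eval_add]
    exact add_pos h0 (hC _)

theorem exists_isOPS_starFunctional (h : IsSymmOPS L P c) :
    ∃ Q, IsOPS (starFunctional L) Q := by
  have hdeg : ∀ n, (C (1 / (parityKernel L P n).eval 1) * parityKernel L P n).natDegree = n :=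
    fun n => by
      rw [natDegree_C_mul (one_div_pos.2 (h.eval_one_parityKernel n)).ne',
        h.natDegree_parityKernel]
  have key : ∀ m n, m < n → ∀ q : ℝ[X], q.natDegree = m →
      starFunctional L (C (1 / (parityKernel L P n).eval 1) * parityKernel L P n * q) = 0 := by
    intro m n hmn q hq
    have hq' : q.degree ≤ m := degree_le_of_natDegree_le hq.le
    rw [starFunctional_apply, mul_assoc, mul_left_comm, ← mul_assoc (1 - X ^ 2),
      h.one_sub_X_sq_mul_parityKernel, map_C_mul, mul_assoc, map_C_mul, mul_comm (P n - _),
      mul_sub q, map_sub,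
      h.map_mul_eq_zero (n := n) (hq'.trans_lt (by exact_mod_cast hmn)),
      h.map_mul_eq_zero (n := n + 2) (hq'.trans_lt (by exact_mod_cast (by omega : m < n + 2)))]
    simp
  refine ⟨fun n => C (1 / (parityKernel L P n).eval 1) * parityKernel L P n, hdeg, ?_, ?_⟩
  · intro m n hmn
    rcases lt_or_gt_of_ne hmn with hlt | hgt
    · rw [mul_comm]
      exact key m n hlt _ (hdeg m)
    · exact key n m hgt _ (hdeg n)
  · intro n
    rw [eval_mul, eval_C]
    exact one_div_mul_cancel (h.eval_one_parityKernel n).ne'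

/-- D_k P_n has degree below n, so orthogonality to all degrees below n - 1 under the star
functional leaves only a multiple of Q_{n-1}; evaluation at 1 identifies the factor. -/
theorem starCondition_iff (h : IsSymmOPS L P c) (hQ : IsOPS (starFunctional L) Q)
    (hL : IsPosDef (starFunctional L)) :
    StarCondition P Q k ↔
      ∀ n j, j + 2 ≤ n → L ((1 - X ^ 2) * sievedAW k (P n) * P j) = 0 := by
  constructor
  · intro hst n j hj
    rw [hst n (by omega), mul_assoc, ← starFunctional_apply, mul_assoc, map_C_mul, mul_comm (Q _),
      hQ.map_mul_eq_zero ((h.degree_eq j).trans_lt (by exact_mod_cast (by omega : j < n - 1))),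
      mul_zero]
  · intro ho n hn
    obtain ⟨m, rfl⟩ : ∃ m, n = m + 1 := ⟨n - 1, by omega⟩
    rw [Nat.add_sub_cancel]
    have hd := sievedAW_degree_lt k (h.natDegree_eq (m + 1)).le
    have h1 := hQ.eq_C_mul_of_forall hL (n := m) (p := sievedAW k (P (m + 1)))
      (degree_le_of_lt_succ hd)
      fun j hj => by
        rw [starFunctional_apply, ← mul_assoc]
        exact h.map_mul_eq_zero_of_forall ((hQ.degree_eq j).trans_lt (by exact_mod_cast hj))
          fun i hi => ho (m + 1) i (by omega)
    have h2 := congrArg (eval 1) h1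
    rw [eval_mul, eval_C, hQ.eval_one, mul_one] at h2
    rw [h2]
    exact h1

end IsSymmOPS

/-! ### From measures to functionals -/

/-- Integration of polynomials as a linear functional. -/
noncomputable def polyIntegral (ν : Measure ℝ) (hν : ∀ p : ℝ[X], Integrable (fun x => p.eval x) ν) :
    ℝ[X] →ₗ[ℝ] ℝ where
  toFun p := ∫ x, p.eval x ∂ν
  map_add' p q := by
    simp only [eval_add]
    exact integral_add (hν p) (hν q)
  map_smul' a p := by
    simp only [eval_smul, smul_eq_mul, RingHom.id_apply]
    exact integral_const_mul a _

theorem polyIntegral_apply (ν : Measure ℝ) (hν : ∀ p : ℝ[X], Integrable (fun x => p.eval x) ν)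
    (p : ℝ[X]) : polyIntegral ν hν p = ∫ x, p.eval x ∂ν := rfl

theorem isNormalizedOPS_iff {ν : Measure ℝ} (hν : ∀ p : ℝ[X], Integrable (fun x => p.eval x) ν)
    {P : ℕ → ℝ[X]} : IsNormalizedOPS ν P ↔ IsOPS (polyIntegral ν hν) P := by
  constructor
  · intro h
    exact ⟨h.natDegree_eq, fun m n hmn => by
      simpa [polyIntegral_apply] using h.orthogonal m n hmn, h.eval_one⟩
  · intro h
    exact ⟨h.natDegree_eq, fun m n hmn => by
      simpa [polyIntegral_apply] using h.orthogonal m n hmn, h.eval_one⟩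

namespace IsOrthogonalizationMeasure

variable {μ : Measure ℝ}

theorem ae_mem_Icc (h : IsOrthogonalizationMeasure μ) : ∀ᵐ x ∂μ, x ∈ Set.Icc (-1 : ℝ) 1 :=
  Filter.mem_of_superset Measure.support_mem_ae h.support_subset

theorem integrable_of_continuous (h : IsOrthogonalizationMeasure μ) {f : ℝ → ℝ}
    (hf : Continuous f) : Integrable f μ := by
  have := h.isProbabilityMeasure
  obtain ⟨C, hC⟩ := (isCompact_Icc (a := (-1 : ℝ)) (b := 1)).exists_bound_of_continuousOn
    hf.continuousOn
  exact Integrable.of_bound hf.aestronglyMeasurable C (h.ae_mem_Icc.mono hC)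

theorem integrable_eval (h : IsOrthogonalizationMeasure μ) (p : ℝ[X]) :
    Integrable (fun x => p.eval x) μ :=
  h.integrable_of_continuous p.continuous

/-- A nonnegative polynomial with zero integral vanishes on the support, which is infinite. -/
theorem integral_pos (h : IsOrthogonalizationMeasure μ) {q : ℝ[X]} (hq : q ≠ 0)
    (hpos : ∀ x ∈ Set.Icc (-1 : ℝ) 1, 0 ≤ q.eval x) : 0 < ∫ x, q.eval x ∂μ := by
  have hae : 0 ≤ᵐ[μ] fun x => q.eval x := h.ae_mem_Icc.mono hpos
  refine lt_of_le_of_ne (integral_nonneg_of_ae hae) fun h0 => ?_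
  have h1 := (integral_eq_zero_iff_of_nonneg_ae hae (h.integrable_eval q)).1 h0.symm
  have h2 : μ.support ⊆ {x | q.IsRoot x} :=
    Measure.support_subset_of_isClosed (isClosed_eq q.continuous continuous_const) h1
  exact h.support_infinite ((finite_setOfPred_isRoot hq).subset h2)

theorem integral_neg_comp (h : IsOrthogonalizationMeasure μ) (f : ℝ → ℝ) :
    ∫ x, f (-x) ∂μ = ∫ x, f x ∂μ := by
  conv_rhs => rw [← h.symmetric]
  exact ((Homeomorph.neg ℝ).measurableEmbedding.integral_map f).symm

theorem polyIntegral_one (h : IsOrthogonalizationMeasure μ) :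
    polyIntegral μ h.integrable_eval 1 = 1 := by
  have := h.isProbabilityMeasure
  simp [polyIntegral_apply]

theorem polyIntegral_comp_neg_X (h : IsOrthogonalizationMeasure μ) (p : ℝ[X]) :
    polyIntegral μ h.integrable_eval (p.comp (-X)) = polyIntegral μ h.integrable_eval p := by
  simpa [polyIntegral_apply] using h.integral_neg_comp fun x => p.eval x

theorem isPosDef (h : IsOrthogonalizationMeasure μ) :
    IsPosDef (polyIntegral μ h.integrable_eval) := fun p hp =>
  h.integral_pos (mul_ne_zero hp hp) fun x _ => by
    rw [eval_mul]; exact mul_self_nonneg _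

theorem polyIntegral_one_sub_X_mul_pos (h : IsOrthogonalizationMeasure μ) (p : ℝ[X]) (hp : p ≠ 0) :
    0 < polyIntegral μ h.integrable_eval ((1 - X) * (p * p)) := by
  have h1 : (1 - X : ℝ[X]) ≠ 0 := fun h0 => by
    simpa using congrArg (eval 0) h0
  refine h.integral_pos (mul_ne_zero h1 (mul_ne_zero hp hp)) fun x hx => ?_
  simp only [eval_mul, eval_sub, eval_one, eval_X]
  exact mul_nonneg (by linarith [hx.2]) (mul_self_nonneg _)

theorem isPosDef_starFunctional (h : IsOrthogonalizationMeasure μ) :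
    IsPosDef (starFunctional (polyIntegral μ h.integrable_eval)) := by
  intro p hp
  have h1 : (1 - X ^ 2 : ℝ[X]) ≠ 0 := fun h0 => by
    simpa using congrArg (eval 0) h0
  rw [starFunctional_apply]
  refine h.integral_pos (mul_ne_zero h1 (mul_ne_zero hp hp)) fun x hx => ?_
  simp only [eval_mul, eval_sub, eval_one, eval_pow, eval_X]
  exact mul_nonneg (by nlinarith [hx.1, hx.2]) (mul_self_nonneg _)

theorem measurable_star : Measurable fun x : ℝ => ENNReal.ofReal (1 - x ^ 2) := by fun_prop

theorem ae_star (h : IsOrthogonalizationMeasure μ) (f : ℝ → ℝ) :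
    (fun x => (ENNReal.ofReal (1 - x ^ 2)).toReal • f x) =ᵐ[μ] fun x => (1 - x ^ 2) * f x := by
  filter_upwards [h.ae_mem_Icc] with x hx
  rw [ENNReal.toReal_ofReal (by nlinarith [hx.1, hx.2]), smul_eq_mul]

theorem integrable_star (h : IsOrthogonalizationMeasure μ) (p : ℝ[X]) :
    Integrable (fun x => p.eval x) (starMeasure μ) := by
  rw [starMeasure, integrable_withDensity_iff_integrable_smul' measurable_star
    (Filter.Eventually.of_forall fun _ => ENNReal.ofReal_lt_top), integrable_congr (h.ae_star _)]
  exact h.integrable_of_continuous (by fun_prop)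

theorem polyIntegral_star (h : IsOrthogonalizationMeasure μ) :
    polyIntegral (starMeasure μ) h.integrable_star =
      starFunctional (polyIntegral μ h.integrable_eval) := by
  refine LinearMap.ext fun p => ?_
  rw [starFunctional_apply, polyIntegral_apply, polyIntegral_apply, starMeasure,
    integral_withDensity_eq_integral_toReal_smul measurable_star
    (Filter.Eventually.of_forall fun _ => ENNReal.ofReal_lt_top), integral_congr_ae (h.ae_star _)]
  simp

end IsOrthogonalizationMeasure

/-! ### The case k = 1: Pearson equation and ultraspherical weights -/

section Ultraspherical

variable {α : ℝ}

theorem integrableOn_weight (hα : -1 < α) :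
    IntegrableOn (fun x : ℝ => (1 - x ^ 2) ^ α) (Set.Ioo (-1) 1) := by
  have h1 : IntervalIntegrable (fun x : ℝ => (1 - x) ^ α) volume (-1) 1 := by
    have := (intervalIntegral.intervalIntegrable_rpow' hα (a := 2) (b := 0)).comp_sub_left 1
    norm_num at this
    exact this
  have h2 : IntervalIntegrable (fun x : ℝ => (1 + x) ^ α) volume (-1) 1 := by
    have := (intervalIntegral.intervalIntegrable_rpow' hα (a := 0) (b := 2)).comp_add_left 1
    norm_num at this
    exact this
  -- A majorant for both signs of α: the summand 1 serves α ≥ 0; for α ≤ 0 one of the factors (1 -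
  -- x)^α, (1 + x)^α is at most 1, depending on the sign of x.
  have h3 : IntegrableOn (fun x : ℝ => 1 + ((1 - x) ^ α + (1 + x) ^ α)) (Set.Ioo (-1) 1) := by
    have := (intervalIntegrable_const (c := (1 : ℝ))).add (h1.add h2)
    exact ((intervalIntegrable_iff_integrableOn_Ioo_of_le (by norm_num)).1 this)
  refine h3.mono' ?_ ?_
  · exact (Measurable.pow_const (by fun_prop) α).aestronglyMeasurable
  · refine (ae_restrict_mem measurableSet_Ioo).mono fun x hx => ?_
    have p1 : 0 < 1 - x := by linarith [hx.2]
    have p2 : 0 < 1 + x := by linarith [hx.1]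
    have e : 1 - x ^ 2 = (1 - x) * (1 + x) := by ring
    have q1 := Real.rpow_pos_of_pos p1 α
    have q2 := Real.rpow_pos_of_pos p2 α
    rw [Real.norm_of_nonneg (Real.rpow_nonneg (by rw [e]; positivity) α)]
    rcases le_total 0 α with h0 | h0
    · have := Real.rpow_le_one (z := α) (by rw [e]; positivity : 0 ≤ 1 - x ^ 2)
        (by nlinarith [sq_nonneg x]) h0
      linarith
    · rw [e, Real.mul_rpow p1.le p2.le]
      rcases le_total 0 x with hx0 | hx0
      · have := Real.rpow_le_one_of_one_le_of_nonpos (by linarith : 1 ≤ 1 + x) h0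
        nlinarith
      · have := Real.rpow_le_one_of_one_le_of_nonpos (by linarith : 1 ≤ 1 - x) h0
        nlinarith

theorem measurable_ultrasphericalWeight :
    Measurable fun x : ℝ => ENNReal.ofReal ((1 - x ^ 2) ^ α) :=
  (Measurable.pow_const (by fun_prop) α).ennreal_ofReal

theorem ultrasphericalWeight_smul (f : ℝ → ℝ) :
    (fun x => (ENNReal.ofReal ((1 - x ^ 2) ^ α)).toReal • f x)
      =ᵐ[volume.restrict (Set.Ioo (-1 : ℝ) 1)] fun x => (1 - x ^ 2) ^ α * f x := by
  filter_upwards [ae_restrict_mem measurableSet_Ioo] with x hx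
  rw [ENNReal.toReal_ofReal (Real.rpow_nonneg (by nlinarith [hx.1, hx.2]) α), smul_eq_mul]

theorem integrableOn_weight_mul (hα : -1 < α) {f : ℝ → ℝ} (hf : Continuous f) :
    IntegrableOn (fun x : ℝ => (1 - x ^ 2) ^ α * f x) (Set.Ioo (-1) 1) := by
  obtain ⟨C, hC⟩ := (isCompact_Icc (a := (-1 : ℝ)) (b := 1)).exists_bound_of_continuousOn
    hf.continuousOn
  refine Integrable.mul_bdd (c := C) (integrableOn_weight hα) hf.aestronglyMeasurable ?_
  exact (ae_restrict_mem measurableSet_Ioo).mono fun x hx => hC x (Set.Ioo_subset_Icc_self hx)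

theorem integrable_ultraspherical (hα : -1 < α) (p : ℝ[X]) :
    Integrable (fun x => p.eval x) (ultrasphericalMeasure α) := by
  rw [ultrasphericalMeasure, integrable_withDensity_iff_integrable_smul'
    measurable_ultrasphericalWeight (Filter.Eventually.of_forall fun _ => ENNReal.ofReal_lt_top),
    integrable_congr (ultrasphericalWeight_smul _)]
  exact integrableOn_weight_mul hα p.continuous

theorem polyIntegral_ultraspherical (hα : -1 < α) (p : ℝ[X]) :
    polyIntegral (ultrasphericalMeasure α) (integrable_ultraspherical hα) p =
      ∫ x in (-1 : ℝ)..1, (1 - x ^ 2) ^ α * p.eval x := by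
  rw [polyIntegral_apply, ultrasphericalMeasure, integral_withDensity_eq_integral_toReal_smul
    measurable_ultrasphericalWeight (Filter.Eventually.of_forall fun _ => ENNReal.ofReal_lt_top),
    integral_congr_ae (ultrasphericalWeight_smul _),
    intervalIntegral.integral_of_le (by norm_num), integral_Ioc_eq_integral_Ioo]

theorem polyIntegral_ultraspherical_one_pos (hα : -1 < α) :
    0 < polyIntegral (ultrasphericalMeasure α) (integrable_ultraspherical hα) 1 := by
  rw [polyIntegral_ultraspherical hα]
  refine intervalIntegral.intervalIntegral_pos_of_pos_on ?_ (fun x hx => ?_) (by norm_num)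
  · rw [intervalIntegrable_iff_integrableOn_Ioo_of_le (by norm_num)]
    exact integrableOn_weight_mul hα (1 : ℝ[X]).continuous
  · rw [eval_one, mul_one]
    exact Real.rpow_pos_of_pos (by nlinarith [hx.1, hx.2]) α

/-- The Pearson equation `L ((1 - x²) p') = r L (x p)`. -/
def IsPearson (L : ℝ[X] →ₗ[ℝ] ℝ) (r : ℝ) : Prop :=
  ∀ p : ℝ[X], L ((1 - X ^ 2) * derivative p) = r * L (X * p)

/-- Integrate the derivative of (1 - x²)^(α+1) p(x); the boundary terms vanish since α + 1 > 0. -/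
theorem isPearson_ultraspherical (hα : -1 < α) :
    IsPearson (polyIntegral (ultrasphericalMeasure α) (integrable_ultraspherical hα))
      (2 * α + 2) := by
  intro p
  rw [← map_C_mul, ← sub_eq_zero, ← map_sub, polyIntegral_ultraspherical hα]
  have hcont : Continuous fun x : ℝ => (1 - x ^ 2) ^ (α + 1) * p.eval x :=
    (Continuous.rpow_const (by fun_prop) fun _ => Or.inr (by linarith)).mul p.continuous
  have hd : ∀ x ∈ Set.Ioo (-1 : ℝ) 1, HasDerivAt (fun x : ℝ => (1 - x ^ 2) ^ (α + 1) * p.eval x)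
      ((1 - x ^ 2) ^ α * ((1 - X ^ 2) * derivative p - C (2 * α + 2) * (X * p)).eval x) x := by
    intro x hx
    have hx0 : 0 < 1 - x ^ 2 := by nlinarith [hx.1, hx.2]
    have h1 : HasDerivAt (fun x : ℝ => 1 - x ^ 2) (-(2 * x)) x := by
      simpa using (hasDerivAt_pow 2 x).const_sub 1
    have h2 := (h1.rpow_const (p := α + 1) (Or.inl hx0.ne')).mul (p.hasDerivAt x)
    refine h2.congr_deriv ?_
    rw [add_sub_cancel_right, Real.rpow_add hx0, Real.rpow_one]
    simp only [eval_sub, eval_mul, eval_C, eval_X, eval_pow, eval_one]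
    ring
  rw [intervalIntegral.integral_eq_sub_of_hasDerivAt_of_le (by norm_num) hcont.continuousOn hd]
  · have : α + 1 ≠ 0 := by linarith
    norm_num [Real.zero_rpow this]
  · rw [intervalIntegrable_iff_integrableOn_Ioo_of_le (by norm_num)]
    exact integrableOn_weight_mul hα (Polynomial.continuous _)

/-- A functional which satisfies the Pearson equation is determined up to normalization. -/
theorem IsPearson.eq_mul {L M : ℝ[X] →ₗ[ℝ] ℝ} {r : ℝ} (hr : 0 < r) (hL : IsPearson L r)
    (hM : IsPearson M r) (hL1 : L 1 = 1) (p : ℝ[X]) : M p = M 1 * L p := by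
  have hX : ∀ {K : ℝ[X] →ₗ[ℝ] ℝ}, IsPearson K r → K X = 0 := fun {K} hK => by
    have := hK 1
    simpa [hr.ne'] using this
  -- The Pearson equation for x^{m+1} is a two-step recursion for the moments, and for p = 1 it
  -- kills the first moment.
  have hpow : ∀ {K : ℝ[X] →ₗ[ℝ] ℝ}, IsPearson K r → ∀ m : ℕ,
      K (X ^ (m + 2)) = (m + 1) / (m + 1 + r) * K (X ^ m) := fun {K} hK m => by
    have h1 := hK (X ^ (m + 1))
    rw [derivative_X_pow] at h1
    have h2 : (1 - X ^ 2) * (C ((m + 1 : ℕ) : ℝ) * X ^ (m + 1 - 1)) =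
        C ((m : ℝ) + 1) * (X ^ m - X ^ (m + 2)) := by
      rw [Nat.add_sub_cancel]; push_cast; ring
    rw [h2, map_C_mul, map_sub, show (X : ℝ[X]) * X ^ (m + 1) = X ^ (m + 2) by ring] at h1
    have : 0 < (m : ℝ) + 1 + r := by positivity
    rw [div_mul_eq_mul_div, eq_div_iff this.ne']
    linarith
  have key : ∀ m : ℕ, M (X ^ m) = M 1 * L (X ^ m) := by
    intro m
    induction m using Nat.twoStepInduction with
    | zero => simp [hL1]
    | one => simp [hX hL, hX hM]
    | more m h0 _ => rw [hpow hL, hpow hM, h0]; ring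
  induction p using Polynomial.induction_on' with
  | add p q hp hq => rw [map_add, map_add, hp, hq]; ring
  | monomial n a => rw [← C_mul_X_pow_eq_monomial, map_C_mul, map_C_mul, key]; ring

/-- Test the Pearson equation on P_n: for n ≥ 2 both sides vanish, and n = 1 fixes r through L(x²) =
c_1. Conversely, apply it to P_nP_j; the remaining terms pair P_n with polynomials of lower degree.
-/
theorem IsSymmOPS.orthogonal_iff_isPearson {L : ℝ[X] →ₗ[ℝ] ℝ} {P : ℕ → ℝ[X]} {c : ℕ → ℝ}
    (h : IsSymmOPS L P c) :
    (∀ n j, j + 2 ≤ n → L ((1 - X ^ 2) * sievedAW 1 (P n) * P j) = 0) ↔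
      IsPearson L (1 / c 1 - 1) := by
  have hr := h.isRecurrenceCoeff
  simp only [sievedAW_one_eq_derivative]
  have hX : L X = 0 := by
    have := h.orthogonal 1 0 (by omega)
    rwa [hr.zero_eq_one, hr.one_eq_X, mul_one] at this
  have p1 : c 1 ≠ 0 := (hr.pos 0).ne'
  constructor
  · intro ho
    refine h.induction (by simp) fun p a n hp => ?_
    have hn : L ((1 - X ^ 2) * derivative (P n)) = (1 / c 1 - 1) * L (X * P n) := by
      rcases n with _ | _ | n
      · simp [hr.zero_eq_one, hX]
      · have h2 : L (X ^ 2) = c 1 := by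
          have := h.norm_succ 0
          simp only [hr.coeff_zero, hr.zero_eq_one, zero_add, mul_one, h.map_one, sub_zero,
            one_mul, hr.one_eq_X] at this
          rw [pow_two, this]
        rw [zero_add, hr.one_eq_X, derivative_X, mul_one, map_sub, h.map_one, ← pow_two, h2]
        field_simp
      · have h2 := ho (n + 2) 0 (by omega)
        rw [hr.zero_eq_one, mul_one] at h2
        rw [h2, ← hr.one_eq_X, h.orthogonal 1 (n + 1 + 1) (by omega), mul_zero]
    rw [derivative_add, derivative_C_mul, mul_add, mul_add, map_add, map_add, hp,
      mul_left_comm, mul_left_comm X, map_C_mul, map_C_mul, hn]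
    ring
  · intro hp n j hj
    have e : (1 - X ^ 2) * derivative (P n) * P j = (1 - X ^ 2) * derivative (P n * P j) -
        (1 - X ^ 2) * derivative (P j) * P n := by
      rw [derivative_mul]; ring
    have d1 : (X * P j).degree < (n : WithBot ℕ) := by
      rw [degree_mul, degree_X, h.degree_eq]; norm_cast; omega
    have d2 : ((1 - X ^ 2) * derivative (P j)).degree < (n : WithBot ℕ) := by
      by_cases h0 : derivative (P j) = 0
      · simp [h0]
      have h3 := degree_derivative_lt (h.ne_zero j)
      rw [h.degree_eq, degree_eq_natDegree h0] at h3
      have h4 : (1 - X ^ 2 : ℝ[X]).natDegree ≤ 2 := by compute_degree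
      have h5 := natDegree_mul_le (p := (1 - X ^ 2 : ℝ[X])) (q := derivative (P j))
      norm_cast at h3
      exact degree_le_natDegree.trans_lt (by exact_mod_cast (by omega))
    rw [e, map_sub, hp, h.map_mul_eq_zero d2, show X * (P n * P j) = X * P j * P n by ring,
      h.map_mul_eq_zero d1]
    ring

theorem IsSymmOPS.isPearson_iff_isUltraspherical {L : ℝ[X] →ₗ[ℝ] ℝ} {P : ℕ → ℝ[X]} {c : ℕ → ℝ}
    (h : IsSymmOPS L P c) :
    IsPearson L (1 / c 1 - 1) ↔ IsUltraspherical (1 / (2 * c 1) - 3 / 2) P := by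
  have hr := h.isRecurrenceCoeff
  have p1 : 0 < c 1 := hr.pos 0
  have hr0 : 0 < 1 / c 1 - 1 := by
    rw [sub_pos, lt_one_div one_pos p1, div_one]
    linarith [hr.one_sub_pos 1]
  have hα : (2 : ℝ) * (1 / (2 * c 1) - 3 / 2) + 2 = 1 / c 1 - 1 := by
    field_simp; ring
  have hα' : -1 < 1 / (2 * c 1) - 3 / 2 := by linarith
  have hM := isPearson_ultraspherical hα'
  rw [hα] at hM
  rw [IsUltraspherical, isNormalizedOPS_iff (integrable_ultraspherical hα')]
  have hM1 := polyIntegral_ultraspherical_one_pos hα'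
  set M := polyIntegral (ultrasphericalMeasure (1 / (2 * c 1) - 3 / 2))
    (integrable_ultraspherical hα')
  constructor
  · intro hL
    refine ⟨hα', h.natDegree_eq, fun m n hmn => ?_, h.eval_one⟩
    rw [hL.eq_mul hr0 hM h.map_one, h.orthogonal m n hmn, mul_zero]
  · rintro ⟨-, hP⟩ p
    -- Sharing an orthogonal sequence makes functionals proportional, as both vanish on P_n for n ≥
    -- 1.
    have key : ∀ p, M p = M 1 * L p := by
      refine h.induction (by simp) fun p a n hp => ?_
      have hn : M (P n) = M 1 * L (P n) := by
        rcases n with _ | n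
        · rw [hr.zero_eq_one, h.map_one, mul_one]
        · have e1 := hP.orthogonal (n + 1) 0 (by omega)
          have e2 := h.orthogonal (n + 1) 0 (by omega)
          rw [hr.zero_eq_one, mul_one] at e1 e2
          rw [e1, e2, mul_zero]
      rw [map_add, map_add, map_C_mul, map_C_mul, hp, hn]
      ring
    have := hM p
    rw [key, key (X * p)] at this
    refine mul_left_cancel₀ hM1.ne' ?_
    linarith

end Ultraspherical

/-! ### The RWPS underlying a sieved sequence -/

/-- The polynomials with prescribed recurrence coefficients. -/
noncomputable def recPoly (c : ℕ → ℝ) : ℕ → ℝ[X]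
  | 0 => 1
  | 1 => X
  | n + 2 => C (1 / (1 - c (n + 1))) * (X * recPoly c (n + 1) - C (c (n + 1)) * recPoly c n)

theorem isRecurrenceCoeff_recPoly {c : ℕ → ℝ} (h0 : c 0 = 0)
    (hc : ∀ n, 1 ≤ n → c n ∈ Set.Ioo (0 : ℝ) 1) : IsRecurrenceCoeff (recPoly c) c := by
  refine ⟨rfl, h0, hc, fun n => ?_⟩
  rcases n with _ | n
  · simp [recPoly, h0]
  · have h1 : 1 - c (n + 1) ≠ 0 := by linarith [(hc (n + 1) (by omega)).2]
    rw [recPoly, ← mul_assoc, ← C_mul, mul_one_div_cancel h1, Nat.add_sub_cancel]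
    simp

/-- Solution of the Chebyshev recurrence in terms of its initial values. -/
theorem eq_of_chebyshev_recurrence {f : ℕ → ℝ[X]} {k : ℕ}
    (hf : ∀ r, r + 2 ≤ k → f (r + 2) = 2 * X * f (r + 1) - f r) (r : ℕ) (hr : r ≤ k) :
    f r = Chebyshev.T ℝ r * f 0 + Chebyshev.U ℝ ((r : ℤ) - 1) * (f 1 - X * f 0) := by
  induction r using Nat.twoStepInduction with
  | zero => simp
  | one => simp
  | more r h0 h1 =>
    have hT := Chebyshev.T_add_two ℝ (r : ℤ)
    have hU := Chebyshev.U_add_two ℝ ((r : ℤ) - 1)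
    rw [hf r hr, h0 (by omega), h1 (by omega)]
    have e1 : (((r + 2 : ℕ) : ℤ)) = (r : ℤ) + 2 := by push_cast; ring
    have e2 : ((r : ℤ) + 2) - 1 = (r : ℤ) - 1 + 2 := by ring
    have e3 : (((r + 1 : ℕ) : ℤ)) = (r : ℤ) + 1 := by push_cast; ring
    have e4 : ((r : ℤ) + 1) - 1 = (r : ℤ) - 1 + 1 := by ring
    rw [e1, e2, e3, e4, hT, hU]
    ring

section

variable {P : ℕ → ℝ[X]} {c : ℕ → ℝ} {k : ℕ}

theorem IsRecurrenceCoeff.succ_eq_of_half (hr : IsRecurrenceCoeff P c) {n : ℕ}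
    (hn : c n = 1 / 2) : P (n + 1) = 2 * X * P n - P (n - 1) := by
  have h1 := hr.recurrence n
  have h2 : (C (1 / 2 : ℝ) : ℝ[X]) * 2 = 1 := by
    rw [show (2 : ℝ[X]) = C 2 from rfl, ← C_mul]; norm_num
  rw [hn, show (1 : ℝ) - 1 / 2 = 1 / 2 by norm_num] at h1
  linear_combination -2 * h1 - (P (n + 1) + P (n - 1)) * h2

/-- Between multiples of k the sequence follows the Chebyshev recurrence. Solving it upwards and
downwards from kn gives P_{kn±k} = T_k P_{kn} + U_{k-1}(P_{kn±1} - xP_{kn}); weighting by 1 - c_{kn}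
and c_{kn} cancels the U terms. -/
theorem T_mul_eq (hr : IsRecurrenceCoeff P c) (hc : ∀ n, ¬ k ∣ n → c n = 1 / 2)
    (n : ℕ) : Chebyshev.T ℝ k * P (k * n) =
      C (1 - c (k * n)) * P (k * (n + 1)) + C (c (k * n)) * P (k * (n - 1)) := by
  have hup := eq_of_chebyshev_recurrence (f := fun r => P (k * n + r)) (k := k) (fun r hrk => by
    refine hr.succ_eq_of_half (n := k * n + (r + 1)) (hc _ ?_)
    rw [Nat.dvd_add_right (dvd_mul_right k n)]
    exact fun hd => by have := Nat.le_of_dvd (by omega) hd; omega) k le_rfl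
  simp only [add_zero] at hup
  have h1 := hr.recurrence (k * n)
  rcases n with _ | n
  · simp [hr.zero_eq_one, hr.coeff_zero, hr.one_eq_X] at hup ⊢
    exact hup.symm
  · have hle : k ≤ k * (n + 1) := Nat.le_mul_of_pos_right k (by omega)
    have hdown := eq_of_chebyshev_recurrence (f := fun r => P (k * (n + 1) - r)) (k := k)
      (fun r hrk => by
        have e : ¬ k ∣ k * (n + 1) - (r + 1) := by
          intro hd
          have h2 := (Nat.dvd_sub_iff_right (by omega) (dvd_mul_right k (n + 1))).1 hd
          have := Nat.le_of_dvd (by omega) h2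
          omega
        have h3 := hr.succ_eq_of_half (hc _ e)
        rw [show k * (n + 1) - (r + 1) + 1 = k * (n + 1) - r by omega,
          show k * (n + 1) - (r + 1) - 1 = k * (n + 1) - (r + 2) by omega] at h3
        rw [h3]; ring) k le_rfl
    simp only [Nat.sub_zero] at hdown
    rw [show k * (n + 1) - k = k * n by rw [mul_add]; omega] at hdown
    rw [show k * (n + 1) + k = k * (n + 1 + 1) by ring] at hup
    rw [Nat.add_sub_cancel, hup, hdown]
    simp only [map_sub, map_one] at h1 ⊢
    linear_combination Chebyshev.U ℝ ((k : ℤ) - 1) * h1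

theorem recPoly_comp_T (hr : IsRecurrenceCoeff P c)
    (hc : ∀ n, ¬ k ∣ n → c n = 1 / 2) (n : ℕ) :
    (recPoly (fun n => c (k * n)) n).comp (Chebyshev.T ℝ k) = P (k * n) := by
  induction n using Nat.twoStepInduction with
  | zero => simp [recPoly, hr.zero_eq_one]
  | one =>
    have := T_mul_eq hr hc 0
    simpa [recPoly, hr.zero_eq_one, hr.coeff_zero] using this
  | more n h0 h1 =>
    have := T_mul_eq hr hc (n + 1)
    rw [Nat.add_sub_cancel] at this
    have hp := (hr.one_sub_pos (k * (n + 1))).ne'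
    rw [recPoly, mul_comp, sub_comp, mul_comp, mul_comp, h0, h1, C_comp, C_comp, X_comp, this,
      add_sub_cancel_right, ← mul_assoc, ← C_mul, one_div_mul_cancel hp, C_1, one_mul]

end

/-- The symmetrized image of a measure under `T_k`. -/
noncomputable def chebyshevImage (k : ℕ) (μ : Measure ℝ) : Measure ℝ :=
  (2⁻¹ : ENNReal) • (μ.map (fun x => (Chebyshev.T ℝ k).eval x) +
    μ.map (fun x => -(Chebyshev.T ℝ k).eval x))

section chebyshevImage

variable {μ : Measure ℝ} {k : ℕ}

theorem measurable_eval_T : Measurable fun x : ℝ => (Chebyshev.T ℝ k).eval x :=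
  (Chebyshev.T ℝ k).continuous.measurable

theorem measurable_neg_eval_T : Measurable fun x : ℝ => -(Chebyshev.T ℝ k).eval x :=
  (Chebyshev.T ℝ k).continuous.neg.measurable

theorem measure_preimage_of_chebyshevImage_eq_zero {s : Set ℝ} (hs : MeasurableSet s)
    (h : chebyshevImage k μ s = 0) : μ ((fun x => (Chebyshev.T ℝ k).eval x) ⁻¹' s) = 0 := by
  rw [chebyshevImage, Measure.smul_apply, Measure.add_apply, smul_eq_mul, mul_eq_zero,
    add_eq_zero, Measure.map_apply measurable_eval_T hs] at h
  exact (h.resolve_left (by simp)).1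

theorem isOrthogonalizationMeasure_chebyshevImage (h : IsOrthogonalizationMeasure μ)
    (hk : 1 ≤ k) : IsOrthogonalizationMeasure (chebyshevImage k μ) where
  isProbabilityMeasure := by
    have := h.isProbabilityMeasure
    constructor
    rw [chebyshevImage, Measure.smul_apply, Measure.add_apply,
      Measure.map_apply measurable_eval_T MeasurableSet.univ,
      Measure.map_apply measurable_neg_eval_T MeasurableSet.univ, Set.preimage_univ,
      Set.preimage_univ, measure_univ, one_add_one_eq_two, smul_eq_mul]
    exact ENNReal.inv_mul_cancel (by norm_num) (by norm_num)
  symmetric := by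
    rw [chebyshevImage, Measure.map_smul, Measure.map_add _ _ measurable_neg,
      Measure.map_map measurable_neg measurable_eval_T,
      Measure.map_map measurable_neg measurable_neg_eval_T, add_comm]
    congr 3
    funext x
    simp
  support_infinite := by
    intro hfin
    have h1 := measure_preimage_of_chebyshevImage_eq_zero
      Measure.isClosed_support.measurableSet.compl
      (Measure.measure_compl_support (μ := chebyshevImage k μ))
    have h2 : μ.support ⊆ (fun x => (Chebyshev.T ℝ k).eval x) ⁻¹' (chebyshevImage k μ).support :=
      Measure.support_subset_of_isClosed
        (Measure.isClosed_support.preimage (Chebyshev.T ℝ k).continuous) h1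
    -- T_k is nonconstant, so its fibres are finite and a finite image support would force μ to have
    -- finite support.
    refine h.support_infinite ((hfin.preimage' fun y _ => ?_).subset h2)
    have hne : Chebyshev.T ℝ k - C y ≠ 0 := by
      intro h0
      have := congrArg natDegree (sub_eq_zero.1 h0)
      rw [Chebyshev.natDegree_T, natDegree_C] at this
      simp at this
      omega
    refine (finite_setOfPred_isRoot hne).subset fun x hx => ?_
    have hx' : (Chebyshev.T ℝ k).eval x = y := hx
    simp [IsRoot, hx']
  support_subset := by
    have hT : ∀ᵐ x ∂μ, |(Chebyshev.T ℝ k).eval x| ≤ 1 := h.ae_mem_Icc.mono fun x hx =>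
      Chebyshev.abs_eval_T_real_le_one k (abs_le.2 hx)
    refine Measure.support_subset_of_isClosed isClosed_Icc ?_
    rw [mem_ae_iff, chebyshevImage, Measure.smul_apply, Measure.add_apply,
      Measure.map_apply measurable_eval_T measurableSet_Icc.compl,
      Measure.map_apply measurable_neg_eval_T measurableSet_Icc.compl]
    have h1 : μ ((fun x => (Chebyshev.T ℝ k).eval x) ⁻¹' (Set.Icc (-1) 1)ᶜ) = 0 :=
      hT.mono fun x hx => abs_le.1 hx
    have h2 : μ ((fun x => -(Chebyshev.T ℝ k).eval x) ⁻¹' (Set.Icc (-1) 1)ᶜ) = 0 :=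
      hT.mono fun x hx => abs_le.1 (by rwa [abs_neg])
    rw [h1, h2]
    simp

theorem integral_chebyshevImage (h : IsOrthogonalizationMeasure μ) (p : ℝ[X]) :
    ∫ x, p.eval x ∂(chebyshevImage k μ) =
      (∫ x, (p.comp (Chebyshev.T ℝ k)).eval x ∂μ +
        ∫ x, ((p.comp (-X)).comp (Chebyshev.T ℝ k)).eval x ∂μ) / 2 := by
  have i1 : Integrable (fun x => p.eval x) (μ.map fun x => (Chebyshev.T ℝ k).eval x) := by
    rw [integrable_map_measure p.continuous.aestronglyMeasurable measurable_eval_T.aemeasurable]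
    exact h.integrable_of_continuous (p.continuous.comp (Chebyshev.T ℝ k).continuous)
  have i2 : Integrable (fun x => p.eval x) (μ.map fun x => -(Chebyshev.T ℝ k).eval x) := by
    rw [integrable_map_measure p.continuous.aestronglyMeasurable
      measurable_neg_eval_T.aemeasurable]
    exact h.integrable_of_continuous (p.continuous.comp (Chebyshev.T ℝ k).continuous.neg)
  rw [chebyshevImage, integral_smul_measure, integral_add_measure i1 i2,
    integral_map measurable_eval_T.aemeasurable p.continuous.aestronglyMeasurable,
    integral_map measurable_neg_eval_T.aemeasurable p.continuous.aestronglyMeasurable]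
  simp [eval_comp]
  ring

end chebyshevImage

/-- A sequence is sieved as soon as its recurrence coefficients have the required form. -/
theorem isSieved_of_coeff {μ : Measure ℝ} {P : ℕ → ℝ[X]} {c : ℕ → ℝ} {k : ℕ} (hP : IsRWPS μ P)
    (hr : IsRecurrenceCoeff P c) (hk : 1 ≤ k) (hc : ∀ n, ¬ k ∣ n → c n = 1 / 2) :
    IsSieved k P := by
  have hμ := hP.isOrthogonalizationMeasure
  have hr' : IsRecurrenceCoeff (recPoly fun n => c (k * n)) fun n => c (k * n) :=
    isRecurrenceCoeff_recPoly (by simp [hr.coeff_zero]) fun n hn =>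
      hr.coeff_mem _ (Nat.mul_pos hk hn)
  refine ⟨chebyshevImage k μ, recPoly fun n => c (k * n), fun n => c (k * n),
    ⟨isOrthogonalizationMeasure_chebyshevImage hμ hk, ⟨fun n => ?_, fun m n hmn => ?_,
      hr'.eval_one⟩⟩, hr', ?_⟩
  · exact natDegree_eq_of_degree_eq_some (hr'.degree_eq n)
  -- By the parity of the new polynomials, both halves of the symmetrized measure reduce to this one
  -- integral, up to sign.
  · have h0 : ∫ x, (P (k * m)).eval x * (P (k * n)).eval x ∂μ = 0 :=
      hP.isNormalizedOPS.orthogonal _ _ fun he => hmn (Nat.eq_of_mul_eq_mul_left hk he)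
    simp only [← eval_mul] at h0 ⊢
    rw [integral_chebyshevImage hμ]
    simp only [mul_comp, hr'.comp_neg_X, C_comp, recPoly_comp_T hr hc]
    have e : ∀ x : ℝ, (C ((-1) ^ m) * P (k * m) * (C ((-1) ^ n) * P (k * n))).eval x =
        (-1) ^ m * (-1) ^ n * (P (k * m) * P (k * n)).eval x := fun x => by
      simp only [eval_mul, eval_C]; ring
    simp only [e, integral_const_mul, h0]
    simp
  · have : sieve k (fun n => c (k * n)) = c := by
      funext n
      rw [sieve]
      split_ifs with hd
      · rw [Nat.mul_div_cancel' hd]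
      · exact (hc n hd).symm
    rw [this]
    exact hr

theorem isSieved_iff {μ : Measure ℝ} {P : ℕ → ℝ[X]} {c : ℕ → ℝ} {k : ℕ} (hP : IsRWPS μ P)
    (hr : IsRecurrenceCoeff P c) (hk : 1 ≤ k) :
    IsSieved k P ↔ ∀ n, ¬ k ∣ n → c n = 1 / 2 := by
  refine ⟨?_, isSieved_of_coeff hP hr hk⟩
  rintro ⟨_, _, c', _, _, h⟩ n hn
  rw [hr.unique h, sieve, if_neg hn]

/-! ### Translation of the conditions and conclusion -/

theorem IsRWPS.isOPS {μ : Measure ℝ} {P : ℕ → ℝ[X]} (hP : IsRWPS μ P) :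
    IsOPS (polyIntegral μ hP.isOrthogonalizationMeasure.integrable_eval) P :=
  (isNormalizedOPS_iff _).1 hP.isNormalizedOPS

theorem IsRWPS.isSymmOPS {μ : Measure ℝ} {P : ℕ → ℝ[X]} {c : ℕ → ℝ} (hP : IsRWPS μ P)
    (hr : IsRecurrenceCoeff P c) :
    IsSymmOPS (polyIntegral μ hP.isOrthogonalizationMeasure.integrable_eval) P c :=
  ⟨hP.isOPS, hr, hP.isOrthogonalizationMeasure.polyIntegral_one,
    hP.isOrthogonalizationMeasure.polyIntegral_comp_neg_X⟩

theorem orthogonalityCondition_iff {μ : Measure ℝ} {P : ℕ → ℝ[X]} {k : ℕ}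
    (hμ : IsOrthogonalizationMeasure μ) :
    OrthogonalityCondition μ P k ↔ ∀ n j, j + 2 ≤ n →
      polyIntegral μ hμ.integrable_eval ((1 - X ^ 2) * sievedAW k (P n) * P j) = 0 := by
  simp only [polyIntegral_apply, eval_mul, eval_sub, eval_one, eval_pow, eval_X,
    OrthogonalityCondition]
  exact ⟨fun h n j hj => h n (by omega) j (by omega), fun h n hn j hj => h n j (by omega)⟩

theorem kappa_eq_awForm {μ : Measure ℝ} {P : ℕ → ℝ[X]} {k : ℕ}
    (hμ : IsOrthogonalizationMeasure μ) (n j : ℕ) :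
    kappa μ P k n j = awForm (polyIntegral μ hμ.integrable_eval) k (P n) (P j) := by
  simp [kappa, awForm, polyIntegral_apply]

theorem pointwiseCondition_iff {μ : Measure ℝ} {P : ℕ → ℝ[X]} {c : ℕ → ℝ} {k : ℕ}
    (hP : IsRWPS μ P) (hr : IsRecurrenceCoeff P c) :
    PointwiseCondition μ P k ↔ ∀ n,
      ShiftInvariant (polyIntegral μ hP.isOrthogonalizationMeasure.integrable_eval) P k n := by
  have hμ := hP.isOrthogonalizationMeasure
  simp only [PointwiseCondition, sigma, kappa_eq_awForm hμ]
  constructor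
  · rintro ⟨hA, hB⟩
    exact (hP.isSymmOPS hr).shiftInvariant_of_pointwise hA hB
  · intro hs
    constructor
    · intro n hn
      obtain ⟨m, rfl⟩ : ∃ m, n = m + 1 := ⟨n - 1, by omega⟩
      exact (hs (m + 3) m (by omega)).symm
    · intro n hn
      obtain ⟨m, rfl⟩ : ∃ m, n = m + 1 := ⟨n - 1, by omega⟩
      exact ⟨0, Nat.zero_le _, ((hs (m + 5) (m + 2) (by omega)).trans
        (hs (m + 5) m (by omega))).symm⟩

end SievedRWPS

/-- For a random walk polynomial sequence `P` with respect to `μ`, the recurrence coefficients `c`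
and the normalized orthogonal polynomials `Q = P*` of `(1 - x²) dμ` exist and are unique, and the
stated conditions are equivalent for `k ≥ 2` and for `k = 1`, respectively. -/
theorem theorem3p2 (μ : MeasureTheory.Measure ℝ) (P : ℕ → Polynomial ℝ)
    (hP : SievedRWPS.IsRWPS μ P) (k : ℕ) :
    (∃! c : ℕ → ℝ, SievedRWPS.IsRecurrenceCoeff P c) ∧
    (∃! Q : ℕ → Polynomial ℝ, SievedRWPS.IsNormalizedOPS (SievedRWPS.starMeasure μ) Q) ∧
    ∀ (c : ℕ → ℝ) (Q : ℕ → Polynomial ℝ), SievedRWPS.IsRecurrenceCoeff P c →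
      SievedRWPS.IsNormalizedOPS (SievedRWPS.starMeasure μ) Q →
      (2 ≤ k → List.TFAE
        [SievedRWPS.IsSieved k P,
         SievedRWPS.StarCondition P Q k,
         SievedRWPS.OrthogonalityCondition μ P k,
         SievedRWPS.PointwiseCondition μ P k]) ∧
      (k = 1 → List.TFAE
        [SievedRWPS.IsUltraspherical (1 / (2 * c 1) - 3 / 2) P,
         SievedRWPS.StarCondition P Q k,
         SievedRWPS.OrthogonalityCondition μ P k,
         SievedRWPS.PointwiseCondition μ P k]) := by
  have hμ := hP.isOrthogonalizationMeasure
  have hstar : ∀ Q, SievedRWPS.IsNormalizedOPS (SievedRWPS.starMeasure μ) Q ↔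
      SievedRWPS.IsOPS (SievedRWPS.starFunctional
        (SievedRWPS.polyIntegral μ hμ.integrable_eval)) Q := fun Q => by
    rw [SievedRWPS.isNormalizedOPS_iff hμ.integrable_star, hμ.polyIntegral_star]
  obtain ⟨c, hc⟩ := hP.isOPS.exists_isRecurrenceCoeff hμ.isPosDef hμ.polyIntegral_comp_neg_X
    hμ.polyIntegral_one_sub_X_mul_pos
  obtain ⟨Q, hQ⟩ := (hP.isSymmOPS hc).exists_isOPS_starFunctional
  refine ⟨⟨c, hc, fun c' hc' => hc'.unique hc⟩, ⟨Q, (hstar Q).2 hQ, fun Q' hQ' =>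
    ((hstar Q').1 hQ').unique hQ hμ.isPosDef_starFunctional⟩, ?_⟩
  clear! c Q
  intro c Q hc hQ
  have hS := hP.isSymmOPS hc
  have h23 : SievedRWPS.StarCondition P Q k ↔ SievedRWPS.OrthogonalityCondition μ P k :=
    (hS.starCondition_iff ((hstar Q).1 hQ) hμ.isPosDef_starFunctional).trans
      (SievedRWPS.orthogonalityCondition_iff hμ).symm
  have h3s : SievedRWPS.OrthogonalityCondition μ P k ↔ ∀ n, SievedRWPS.ShiftInvariant
      (SievedRWPS.polyIntegral μ hμ.integrable_eval) P k n :=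
    (SievedRWPS.orthogonalityCondition_iff hμ).trans
      (forall_congr' fun n => hS.orthogonal_iff_shiftInvariant n)
  have h34 : SievedRWPS.OrthogonalityCondition μ P k ↔ SievedRWPS.PointwiseCondition μ P k :=
    h3s.trans (SievedRWPS.pointwiseCondition_iff hP hc).symm
  constructor
  · intro hk
    have h13 : SievedRWPS.IsSieved k P ↔ SievedRWPS.OrthogonalityCondition μ P k := by
      rw [SievedRWPS.isSieved_iff hP hc (by omega)]
      constructor
      · intro h
        refine (SievedRWPS.orthogonalityCondition_iff hμ).2 fun n j hj => ?_
        exact hS.orthogonal_of_weight_mul_eq_zero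
          ((SievedRWPS.weight_mul_eq_zero_iff hk).2 h) hj
      · intro h n hn
        exact hS.coeff_eq_half hk (h3s.1 h) hn
    tfae_have 1 ↔ 3 := h13
    tfae_have 2 ↔ 3 := h23
    tfae_have 3 ↔ 4 := h34
    tfae_finish
  · rintro rfl
    have h13 : SievedRWPS.IsUltraspherical (1 / (2 * c 1) - 3 / 2) P ↔
        SievedRWPS.OrthogonalityCondition μ P 1 := by
      rw [SievedRWPS.orthogonalityCondition_iff hμ, hS.orthogonal_iff_isPearson,
        hS.isPearson_iff_isUltraspherical]
    tfae_have 1 ↔ 3 := h13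
    tfae_have 2 ↔ 3 := h23
    tfae_have 3 ↔ 4 := h34
    tfae_finish
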